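/- Let $X$ be a non-compact, locally compact Hausdorff space that is connected and locally connected, and let $\hat X$ be its one-point compactification. Conventions. The empty set counts as connected. A set $A\subseteq X$ is bounded if $\overline A$ is compact, and solid in $X$ if $A$ is connected and every connected component of $X\setminus A$ is unbounded. $\mathcal K_s(X)$ denotes the compact solid sets, $\mathcal O_s^*(X)$ the bounded open solid sets, and $\mathcal A_s^*(X)=\mathcal K_s(X)\cup\mathcal O_s^*(X)$. A solid set function on $X$ is a function $\lambda:\mathcal A_s^*(X)\to[0,\infty)$ such that (s1) $\sum_{i=1}^n\lambda(C_i)\le\lambda(C)$ whenever $C_1,\dots,C_n\in\mathcal K_s(X)$ are disjoint subsets of $C\in\mathcal K_s(X)$; (s2) $\lambda(U)=\sup\{\lambda(K):K\subseteq U,\ K\in\mathcal K_s(X)\}$ for $U\in\mathcal O_s^*(X)$; (s3) $\lambda(K)=\inf\{\lambda(U):K\subseteq U\in\mathcal O_s^*(X)\}$ for $K\in\mathcal K_s(X)$; (s4) $\lambda(A)=\sum_{i=1}^n\lambda(A_i)$ whenever $A\in\mathcal A_s^*(X)$ is the disjoint union of $A_1,\dots,A_n\in\mathcal A_s^*(X)$.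 A topological measure on $X$ is a function $m$ from the open and the closed subsets of $X$ to $[0,\infty]$, not identically $\infty$, such that $m(A\sqcup B)=m(A)+m(B)$ whenever $A$, $B$ and $A\sqcup B$ are each compact or open, $m(U)=\sup\{m(K):K\subseteq U,\ K\text{ compact}\}$ for $U$ open, and $m(F)=\inf\{m(U):F\subseteq U,\ U\text{ open}\}$ for $F$ closed. In the compact space $\hat X$, a set is solid if it and its complement are both connected. A solid partition of $\hat X$ is a partition into non-empty sets, each open solid or closed solid, at most finitely many of them closed; its order is the number of closed sets in it; it is irreducible if its order is at least $2$ and the union of any proper subfamily of its closed sets has connected complement. The genus of $\hat X$ is the supremum of $n-1$ over the orders $n$ of irreducible partitions, and $0$ if there are none. A solid set function on $\hat X$ is a function $\nu\ge 0$, with finite values, on the open solid and the closed solid subsets of $\hat X$ such that $\sum_{i=1}^n\nu(C_i)\le\nu(C)$ whenever $C_1,\dots,C_n$ are disjoint closed solid subsets of a closed solid set $C$; $\nu(U)=\sup\{\nu(K):K\subseteq U,\ K\text{ closed solid}\}$ for $U$ open solid; $\nu(A)+\nu(\hat X\setminus A)=\nu(\hat X)$ for every open solid or closed solid $A$; and $\sum_{A\in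 P}\nu(A)=\nu(\hat X)$ for every finite irreducible partition $P$. Theorem. Suppose that $\hat X$ has genus $0$ and that $\nu$ is a solid set function on $\hat X$. Then every $A\in\mathcal A_s^*(X)$ is solid in $\hat X$, and open or closed there; put $\mu(A)=\nu(A)$. Then $\mu$ is a solid set function on $X$. It extends to a topological measure $m$ on $X$; this $m$ is finite on compact sets and is the only topological measure on $X$ that extends $\mu$. Moreover, every finite partition of a non-empty $A\in\mathcal A_s^*(X)$ into non-empty members of $\mathcal A_s^*(X)$ is trivial, i.e. equal to $\{A\}$. -/

import Mathlib

open scoped NNReal ENNReal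

namespace SolidSet

section LocallyCompact

variable {X : Type*} [TopologicalSpace X]

/-- A set is bounded if its closure is compact. -/
def IsBdd (A : Set X) : Prop := IsCompact (closure A)

/-- A set is solid (in a non-compact space) if it is connected and all connected components of its
complement are unbounded. The empty set counts as connected. -/
def IsSolid (A : Set X) : Prop :=
  IsPreconnected A ∧ ∀ x ∈ Aᶜ, ¬ IsBdd (connectedComponentIn Aᶜ x)

/-- Compact solid sets. -/
def IsCompactSolid (A : Set X) : Prop := IsCompact A ∧ IsSolid A

/-- Bounded open solid sets. -/
def IsBddOpenSolid (A : Set X) : Prop := IsOpen A ∧ IsBdd A ∧ IsSolid A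

/-- The sets that are compact solid or bounded open solid. -/
def IsBddSolid (A : Set X) : Prop := IsCompactSolid A ∨ IsBddOpenSolid A

/-- Solid set functions on a locally compact non-compact space. Only the values of `l` on sets
satisfying `IsBddSolid` matter. -/
structure IsSolidSetFunction (l : Set X → ℝ≥0) : Prop where
  superadditive : ∀ (n : ℕ) (C : Fin n → Set X) (D : Set X), (∀ i, IsCompactSolid (C i)) →
    IsCompactSolid D → Pairwise (fun i j => Disjoint (C i) (C j)) → (⋃ i, C i) ⊆ D →
    ∑ i, l (C i) ≤ l D
  inner_regular : ∀ U : Set X, IsBddOpenSolid U →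
    IsLUB (l '' {K | IsCompactSolid K ∧ K ⊆ U}) (l U)
  outer_regular : ∀ K : Set X, IsCompactSolid K →
    IsGLB (l '' {U | IsBddOpenSolid U ∧ K ⊆ U}) (l K)
  additive : ∀ (n : ℕ) (A : Fin n → Set X), (∀ i, IsBddSolid (A i)) → IsBddSolid (⋃ i, A i) →
    Pairwise (fun i j => Disjoint (A i) (A j)) → l (⋃ i, A i) = ∑ i, l (A i)

/-- Topological measures on a locally compact space. Only the values of `m` on open sets and on
closed sets matter; `m` is not identically infinite there. -/
structure IsTopologicalMeasure (m : Set X → ℝ≥0∞) : Prop where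
  exists_ne_top : ∃ A : Set X, (IsOpen A ∨ IsClosed A) ∧ m A ≠ ∞
  additive : ∀ A B : Set X, (IsCompact A ∨ IsOpen A) → (IsCompact B ∨ IsOpen B) →
    (IsCompact (A ∪ B) ∨ IsOpen (A ∪ B)) → Disjoint A B → m (A ∪ B) = m A + m B
  inner_regular : ∀ U : Set X, IsOpen U → m U = sSup (m '' {K | IsCompact K ∧ K ⊆ U})
  outer_regular : ∀ F : Set X, IsClosed F → m F = sInf (m '' {U | IsOpen U ∧ F ⊆ U})

end LocallyCompact

section Compact

variable {Y : Type*} [TopologicalSpace Y]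

/-- In a compact space, a set is solid if the set and its complement are both connected.
The empty set counts as connected. -/
def IsSolidC (A : Set Y) : Prop := IsPreconnected A ∧ IsPreconnected Aᶜ

/-- A solid partition of a compact space: a partition into non-empty sets each of which is open
solid or closed solid, at most finitely many of them closed. -/
structure IsSolidPartition (P : Set (Set Y)) : Prop where
  nonempty : ∀ A ∈ P, A.Nonempty
  solid : ∀ A ∈ P, IsSolidC A
  open_or_closed : ∀ A ∈ P, IsOpen A ∨ IsClosed A
  disjoint : P.PairwiseDisjoint id
  cover : ⋃₀ P = Set.univ
  finite_closed : {A ∈ P | IsClosed A}.Finite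

/-- The order of a solid partition is the number of closed sets in it. -/
noncomputable def order (P : Set (Set Y)) : ℕ := {A ∈ P | IsClosed A}.ncard

/-- A solid partition is irreducible if its order is at least two and the union of any proper
subfamily of its closed sets has a connected complement. -/
structure IsIrreduciblePartition (P : Set (Set Y)) : Prop extends IsSolidPartition P where
  two_le_order : 2 ≤ order P
  connected_compl : ∀ Q : Set (Set Y), Q ⊂ {A ∈ P | IsClosed A} → IsPreconnected (⋃₀ Q)ᶜ

/-- The genus of a compact space: the largest order of an irreducible partition minus one (`⊤` if
these orders are unbounded), and `0` if there are no irreducible partitions. -/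
noncomputable def genus (Y : Type*) [TopologicalSpace Y] : ℕ∞ :=
  ⨆ P ∈ {P : Set (Set Y) | IsIrreduciblePartition P}, ((order P - 1 : ℕ) : ℕ∞)

/-- Solid set functions on a compact space. Only the values of `l` on sets that are open solid or
closed solid matter. The last two conditions are additivity on the trivial partitions `{A, Aᶜ}` and
on the irreducible partitions. -/
structure IsSolidSetFunctionC (l : Set Y → ℝ≥0) : Prop where
  superadditive : ∀ (n : ℕ) (C : Fin n → Set Y) (D : Set Y),
    (∀ i, IsClosed (C i) ∧ IsSolidC (C i)) → IsClosed D ∧ IsSolidC D →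
    Pairwise (fun i j => Disjoint (C i) (C j)) → (⋃ i, C i) ⊆ D → ∑ i, l (C i) ≤ l D
  inner_regular : ∀ U : Set Y, IsOpen U → IsSolidC U →
    IsLUB (l '' {K | (IsClosed K ∧ IsSolidC K) ∧ K ⊆ U}) (l U)
  additive_trivial : ∀ A : Set Y, IsOpen A ∨ IsClosed A → IsSolidC A →
    l A + l Aᶜ = l Set.univ
  additive_irreducible : ∀ P : Finset (Set Y), IsIrreduciblePartition (P : Set (Set Y)) →
    ∑ A ∈ P, l A = l Set.univ

end Compact

end SolidSet

/-!
The one-point compactification `Y` of `X` is compact, Hausdorff, connected and, since `X` is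
connected and locally connected, also locally connected at infinity. Genus zero says that there
are no irreducible partitions of `Y`, and this means that finitely many disjoint closed solid sets
never separate `Y` (`isPreconnected_compl_sUnion_closed_solid`). An approximation argument gives
the same for disjoint open solid sets (`isPreconnected_compl_sUnion_open_solid`). Consequently a
finite partition of `Y` into solid sets has at most one open and one closed member
(`card_partition_le_two`), so that bounded solid subsets of `X` have only trivial partitions. This
makes additivity of the restriction of `ν` to `X` automatic; its regularity is that of `ν`, since
the open and the closed subsets of `X` that are solid in `Y` are solid in `X`. For open sets this
is a form of boundary bumping (`isSolid_of_isSolidC_image_of_isOpen`).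

The topological measure is constructed on `Y`. Call a continuum tame if its complement has finitely
many components. These components are open solid, so additivity forces the value
`ν Y - ∑ ν B` on the continuum, the sum being over the components `B`. The value `openValue ν U` of
an open set is the supremum of the total values of finite disjoint families of tame continua in `U`.
The crux is that removing such a family `𝒦` from `Y` leaves exactly the mass `ν Y - ∑ value K`
(`openValue_compl_tameFamily`). Both inequalities are proved by induction on `𝒦`, in a form in which
also a finite disjoint family of closed solid sets is removed: a member `K` of `𝒦` splits everything
else among the components `B` of its complement, and in each `B` the set `Bᶜ` joins the family of
closed solid sets (`sum_continuumValue_add_le`, `le_openValue_compl`). Because finite unions of tame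
continua are cofinal among the closed subsets of any open set (`exists_tameFamily_between`), this
identity yields that the values of a closed set and of its complement add up to `ν Y`, from which
regularity and additivity follow. The topological measure on `X` is the restriction of the one on
`Y`.

For uniqueness, additivity determines a topological measure on the tame continua in `X`, by means of
the compact solid set obtained by filling in the bounded components of the complement
(`IsTopologicalMeasure.eq_on_tame`). Cofinality then determines it on open sets, and outer
regularity on closed sets.
-/

namespace SolidSet

open Set Topology

/-! ### Components and solid sets in locally connected spaces -/

section Components

variable {Y : Type*} [TopologicalSpace Y]

/-- The set of connected components of a subset of a topological space. -/
def components (F : Set Y) : Set (Set Y) := connectedComponentIn F '' F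

lemma isPreconnected_of_mem_components {F V : Set Y} (h : V ∈ components F) :
    IsPreconnected V := by
  obtain ⟨x, -, rfl⟩ := h
  exact isPreconnected_connectedComponentIn

lemma nonempty_of_mem_components {F V : Set Y} (h : V ∈ components F) : V.Nonempty := by
  obtain ⟨x, hx, rfl⟩ := h
  exact ⟨x, mem_connectedComponentIn hx⟩

lemma subset_of_mem_components {F V : Set Y} (h : V ∈ components F) : V ⊆ F := by
  obtain ⟨x, -, rfl⟩ := h
  exact connectedComponentIn_subset F x

lemma sUnion_components (F : Set Y) : ⋃₀ components F = F := by
  refine subset_antisymm (sUnion_subset fun V hV => subset_of_mem_components hV) fun x hx => ?_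
  exact ⟨_, ⟨x, hx, rfl⟩, mem_connectedComponentIn hx⟩

lemma eq_connectedComponentIn_of_mem_components {F V : Set Y} (h : V ∈ components F) {x : Y}
    (hx : x ∈ V) : V = connectedComponentIn F x := by
  obtain ⟨y, -, rfl⟩ := h
  exact connectedComponentIn_eq hx

lemma eq_of_mem_components {F V W : Set Y} (hV : V ∈ components F) (hW : W ∈ components F)
    (h : (V ∩ W).Nonempty) : V = W := by
  obtain ⟨x, h1, h2⟩ := h
  rw [eq_connectedComponentIn_of_mem_components hV h1,
    eq_connectedComponentIn_of_mem_components hW h2]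

lemma pairwiseDisjoint_components (F : Set Y) : (components F).PairwiseDisjoint id := by
  intro V hV W hW hne
  by_contra h
  exact hne (eq_of_mem_components hV hW (not_disjoint_iff_nonempty_inter.1 h))

lemma exists_subset_mem_components {F S : Set Y} (hS : IsPreconnected S) (hne : S.Nonempty)
    (h : S ⊆ F) : ∃ V ∈ components F, S ⊆ V := by
  obtain ⟨x, hx⟩ := hne
  exact ⟨_, ⟨x, h hx, rfl⟩, hS.subset_connectedComponentIn hx h⟩

lemma isOpen_of_mem_components [LocallyConnectedSpace Y] {F V : Set Y} (hF : IsOpen F)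
    (h : V ∈ components F) : IsOpen V := by
  obtain ⟨x, -, rfl⟩ := h
  exact hF.connectedComponentIn

lemma closure_component_subset [LocallyConnectedSpace Y] {F V : Set Y} (hF : IsOpen F)
    (h : V ∈ components F) : closure V ⊆ V ∪ Fᶜ := by
  intro x hx
  by_cases hxF : x ∈ F
  · left
    have h1 : connectedComponentIn F x ∈ components F := ⟨x, hxF, rfl⟩
    have h2 := mem_closure_iff.1 hx _ (isOpen_of_mem_components hF h1)
      (mem_connectedComponentIn hxF)
    rw [← eq_of_mem_components h1 h h2]
    exact mem_connectedComponentIn hxF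
  · exact Or.inr hxF

/-- In a connected, locally connected space the closure of a component of a proper open subset
leaves that subset, as the component would otherwise be clopen. -/
lemma closure_component_inter_compl [LocallyConnectedSpace Y] [PreconnectedSpace Y] {F V : Set Y}
    (hF : IsOpen F) (hne : F ≠ univ) (h : V ∈ components F) : (closure V ∩ Fᶜ).Nonempty := by
  by_contra hcon
  rw [not_nonempty_iff_eq_empty] at hcon
  have hcl : IsClosed V := by
    refine isClosed_of_closure_subset fun x hx => ?_
    rcases closure_component_subset hF h hx with h1 | h1
    · exact h1
    · exact absurd (hcon.subset ⟨hx, h1⟩) (notMem_empty x)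
  have := IsClopen.eq_univ ⟨hcl, isOpen_of_mem_components hF h⟩ (nonempty_of_mem_components h)
  exact hne (univ_subset_iff.1 (this ▸ subset_of_mem_components h))

lemma components_sUnion [LocallyConnectedSpace Y] {ℬ : Set (Set Y)} (ho : ∀ B ∈ ℬ, IsOpen B)
    (hc : ∀ B ∈ ℬ, IsPreconnected B) (hne : ∀ B ∈ ℬ, B.Nonempty) (hd : ℬ.PairwiseDisjoint id) :
    components (⋃₀ ℬ) = ℬ := by
  have key : ∀ B ∈ ℬ, ∀ x ∈ B, connectedComponentIn (⋃₀ ℬ) x = B := by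
    intro B hB x hx
    refine subset_antisymm ?_
      ((hc B hB).subset_connectedComponentIn hx (subset_sUnion_of_mem hB))
    have hrest : IsOpen (⋃₀ (ℬ \ {B})) := isOpen_sUnion fun C hC => ho C hC.1
    refine isPreconnected_connectedComponentIn.subset_left_of_subset_union (ho B hB) hrest ?_ ?_
      ⟨x, mem_connectedComponentIn ⟨B, hB, hx⟩, hx⟩
    · rw [disjoint_sUnion_right]
      exact fun C hC => hd hB hC.1 (fun h => hC.2 h.symm)
    · refine (connectedComponentIn_subset _ _).trans ?_
      rintro y ⟨C, hC, hy⟩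
      by_cases h : C = B
      · exact Or.inl (h ▸ hy)
      · exact Or.inr ⟨C, ⟨hC, h⟩, hy⟩
  ext V
  constructor
  · rintro ⟨x, ⟨B, hB, hx⟩, rfl⟩
    rwa [key B hB x hx]
  · intro hV
    obtain ⟨x, hx⟩ := hne V hV
    exact ⟨x, ⟨V, hV, hx⟩, key V hV x hx⟩

lemma isPreconnected_union_of_closure {V D : Set Y} (hV : IsPreconnected V)
    (hD : IsPreconnected D) (h : (closure V ∩ D).Nonempty) : IsPreconnected (V ∪ D) := by
  obtain ⟨x, hx, hxD⟩ := h
  have h1 : IsPreconnected (insert x V) :=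
    hV.subset_closure (subset_insert _ _) (insert_subset hx subset_closure)
  have h2 := h1.union' ⟨x, mem_insert _ _, hxD⟩ hD
  convert h2 using 1
  ext y
  simp only [mem_union, mem_insert_iff]
  constructor
  · tauto
  · rintro ((rfl | h) | h) <;> tauto

/-- A component of the complement of a nonempty closed connected set has connected complement. -/
lemma isPreconnected_compl_component [LocallyConnectedSpace Y] [PreconnectedSpace Y] {K B : Set Y}
    (hK : IsClosed K) (hc : IsPreconnected K) (hne : K.Nonempty) (hB : B ∈ components Kᶜ) :
    IsPreconnected Bᶜ := by
  obtain ⟨p, hp⟩ := hne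
  have hU : Bᶜ = ⋃₀ (insert K ((fun V => V ∪ K) '' (components Kᶜ \ {B}))) := by
    ext x
    constructor
    · intro hx
      by_cases hxK : x ∈ K
      · exact ⟨K, mem_insert _ _, hxK⟩
      · refine ⟨_, Or.inr ⟨connectedComponentIn Kᶜ x, ⟨⟨x, hxK, rfl⟩, ?_⟩, rfl⟩,
          Or.inl (mem_connectedComponentIn hxK)⟩
        rintro rfl
        exact hx (mem_connectedComponentIn hxK)
    · rintro ⟨S, rfl | ⟨V, ⟨hV, hVB⟩, rfl⟩, hxS⟩ hxB
      · exact subset_of_mem_components hB hxB hxS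
      · rcases hxS with h | h
        · exact hVB (eq_of_mem_components hV hB ⟨x, h, hxB⟩)
        · exact subset_of_mem_components hB hxB h
  rw [hU]
  refine isPreconnected_sUnion p _ ?_ ?_
  · rintro S (rfl | ⟨V, -, rfl⟩)
    · exact hp
    · exact Or.inr hp
  · rintro S (rfl | ⟨V, ⟨hV, -⟩, rfl⟩)
    · exact hc
    · refine isPreconnected_union_of_closure (isPreconnected_of_mem_components hV) hc ?_
      have := closure_component_inter_compl hK.isOpen_compl
        (fun h => (h ▸ mem_univ p : p ∈ Kᶜ) hp) hV
      rwa [compl_compl] at this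

lemma isSolidC_component [LocallyConnectedSpace Y] [PreconnectedSpace Y] {K B : Set Y}
    (hK : IsClosed K) (hc : IsPreconnected K) (hne : K.Nonempty) (hB : B ∈ components Kᶜ) :
    IsSolidC B :=
  ⟨isPreconnected_of_mem_components hB, isPreconnected_compl_component hK hc hne hB⟩

lemma IsSolidC.compl {A : Set Y} (h : IsSolidC A) : IsSolidC Aᶜ :=
  ⟨h.2, by rw [compl_compl]; exact h.1⟩

lemma isSolidC_empty [PreconnectedSpace Y] : IsSolidC (∅ : Set Y) :=
  ⟨isPreconnected_empty, by rw [compl_empty]; exact isPreconnected_univ⟩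

lemma isClosed_sUnion_finset {𝒮 : Finset (Set Y)} (h : ∀ S ∈ 𝒮, IsClosed S) :
    IsClosed (⋃₀ (𝒮 : Set (Set Y))) := by
  rw [sUnion_eq_biUnion]
  exact 𝒮.finite_toSet.isClosed_biUnion h

lemma exists_finset_subcover_sUnion {C : Set Y} {𝒮 : Set (Set Y)} (hC : IsCompact C)
    (ho : ∀ S ∈ 𝒮, IsOpen S) (hcov : C ⊆ ⋃₀ 𝒮) :
    ∃ T : Finset (Set Y), (T : Set (Set Y)) ⊆ 𝒮 ∧ C ⊆ ⋃₀ (T : Set (Set Y)) := by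
  rw [sUnion_eq_biUnion] at hcov
  obtain ⟨T, hT, hTfin, hTcov⟩ := hC.elim_finite_subcover_image ho hcov
  lift T to Finset (Set Y) using hTfin
  exact ⟨T, hT, by rwa [sUnion_eq_biUnion]⟩

/-- In a locally connected compact Hausdorff space, a compact subset of a connected open set `U`
lies in a closed connected subset of `U`. -/
lemma exists_continuum_between [CompactSpace Y] [T2Space Y] [LocallyConnectedSpace Y]
    {U C : Set Y} (hU : IsOpen U) (hc : IsPreconnected U) (hC : IsCompact C) (hCU : C ⊆ U) :
    ∃ D, IsClosed D ∧ IsPreconnected D ∧ C ⊆ D ∧ D ⊆ U := by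
  rcases U.eq_empty_or_nonempty with rfl | ⟨p, hp⟩
  · exact ⟨∅, isClosed_empty, isPreconnected_empty, hCU, subset_rfl⟩
  have hloc : ∀ x ∈ U, ∃ N ∈ 𝓝 x, IsClosed N ∧ IsPreconnected N ∧ N ⊆ U := by
    intro x hx
    obtain ⟨N, hN, hNc, hNU⟩ := exists_mem_nhds_isClosed_subset (hU.mem_nhds hx)
    obtain ⟨W, hW, hWc, hWN⟩ := locallyConnectedSpace_iff_connected_subsets.1 inferInstance x N hN
    exact ⟨closure W, Filter.mem_of_superset hW subset_closure, isClosed_closure, hWc.closure,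
      (closure_minimal hWN hNc).trans hNU⟩
  -- the points that a closed connected subset of `U` joins to `p` form a clopen subset of `U`
  let S : Set Y := {x | ∃ D, IsClosed D ∧ IsPreconnected D ∧ D ⊆ U ∧ p ∈ D ∧ D ∈ 𝓝 x}
  have step : ∀ x N, N ∈ 𝓝 x → IsClosed N → IsPreconnected N → N ⊆ U → (N ∩ S).Nonempty →
      x ∈ S := by
    rintro x N hN hNc hNp hNU ⟨y, hyN, D, hD, hDp, hDU, hpD, hDy⟩
    exact ⟨D ∪ N, hD.union hNc, hDp.union' ⟨y, mem_of_mem_nhds hDy, hyN⟩ hNp,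
      union_subset hDU hNU, Or.inl hpD, Filter.mem_of_superset hN subset_union_right⟩
  have hSopen : IsOpen S := by
    rw [isOpen_iff_mem_nhds]
    rintro x ⟨D, hD, hDp, hDU, hpD, hDx⟩
    filter_upwards [eventually_mem_nhds_iff.2 hDx] with y hy
    exact ⟨D, hD, hDp, hDU, hpD, hy⟩
  have hpS : p ∈ S := by
    obtain ⟨N, hN, hNc, hNp, hNU⟩ := hloc p hp
    exact ⟨N, hNc, hNp, hNU, mem_of_mem_nhds hN, hN⟩
  have hUS : U ⊆ S := by
    refine hc.subset_of_closure_inter_subset hSopen ⟨p, hp, hpS⟩ ?_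
    rintro x ⟨hx, hxU⟩
    obtain ⟨N, hN, hNc, hNp, hNU⟩ := hloc x hxU
    obtain ⟨y, hy, hyS⟩ := mem_closure_iff_nhds.1 hx N hN
    exact step x N hN hNc hNp hNU ⟨y, hy, hyS⟩
  have : ∃ D, IsClosed D ∧ IsPreconnected D ∧ C ⊆ D ∧ D ⊆ U ∧ p ∈ D := by
    refine hC.induction_on (p := fun s => ∃ D, IsClosed D ∧ IsPreconnected D ∧ s ⊆ D ∧ D ⊆ U ∧
      p ∈ D) ?_ ?_ ?_ ?_
    · exact ⟨{p}, isClosed_singleton, isPreconnected_singleton, empty_subset _,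
        singleton_subset_iff.2 hp, rfl⟩
    · rintro s t hst ⟨D, h1, h2, h3, h4⟩
      exact ⟨D, h1, h2, hst.trans h3, h4⟩
    · rintro s t ⟨D, h1, h2, h3, h4, h5⟩ ⟨E, k1, k2, k3, k4, k5⟩
      exact ⟨D ∪ E, h1.union k1, h2.union' ⟨p, h5, k5⟩ k2, union_subset_union h3 k3,
        union_subset h4 k4, Or.inl h5⟩
    · intro x hx
      obtain ⟨D, hD, hDp, hDU, hpD, hDx⟩ := hUS (hCU hx)
      exact ⟨D, mem_nhdsWithin_of_mem_nhds hDx, D, hD, hDp, subset_rfl, hDU, hpD⟩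
  obtain ⟨D, h1, h2, h3, h4, -⟩ := this
  exact ⟨D, h1, h2, h3, h4⟩

/-- A closed subset of an open solid set `U` lies in a closed solid subset of `U`: fill in all
components of the complement of a continuum in `U`, except the one that contains `Uᶜ`. -/
lemma exists_closed_solid_between [CompactSpace Y] [T2Space Y] [LocallyConnectedSpace Y]
    [PreconnectedSpace Y] {U C : Set Y} (hU : IsOpen U) (hs : IsSolidC U) (hC : IsClosed C)
    (hCU : C ⊆ U) : ∃ D, (IsClosed D ∧ IsSolidC D) ∧ C ⊆ D ∧ D ⊆ U := by
  obtain ⟨D, hD, hDc, hCD, hDU⟩ := exists_continuum_between hU hs.1 hC.isCompact hCU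
  rcases D.eq_empty_or_nonempty with rfl | hne
  · exact ⟨∅, ⟨isClosed_empty, isSolidC_empty⟩, hCD, hDU⟩
  rcases eq_or_ne U univ with rfl | hUne
  · refine ⟨univ, ⟨isClosed_univ, ?_⟩, hCU, subset_rfl⟩
    simpa using isSolidC_empty.compl
  obtain ⟨B, hB, hUB⟩ := exists_subset_mem_components hs.2 (nonempty_compl.2 hUne)
    (compl_subset_compl.2 hDU)
  refine ⟨Bᶜ, ⟨(isOpen_of_mem_components hD.isOpen_compl hB).isClosed_compl,
    (isSolidC_component hD hDc hne hB).compl⟩, ?_, compl_subset_comm.1 hUB⟩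
  exact hCD.trans (subset_compl_comm.1 (subset_of_mem_components hB))

end Components

/-! ### Genus zero -/

section GenusZero

variable {Y : Type*} [TopologicalSpace Y]

lemma not_isIrreduciblePartition_of_genus_eq_zero (hg : genus Y = 0) (P : Set (Set Y)) :
    ¬ IsIrreduciblePartition P := by
  intro hP
  have h1 : ((order P - 1 : ℕ) : ℕ∞) ≤ genus Y :=
    le_iSup₂_of_le (f := fun (P : Set (Set Y))
      (_ : P ∈ {P : Set (Set Y) | IsIrreduciblePartition P}) => ((order P - 1 : ℕ) : ℕ∞))
      P hP le_rfl
  rw [hg, nonpos_iff_eq_zero, Nat.cast_eq_zero] at h1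
  have := hP.two_le_order
  omega

/-- A tame continuum: a nonempty closed connected set whose complement has finitely many
components. -/
structure IsTame (K : Set Y) : Prop where
  isClosed : IsClosed K
  isPreconnected : IsPreconnected K
  nonempty : K.Nonempty
  finite : (components Kᶜ).Finite

/-- A finite family of pairwise disjoint tame continua. -/
structure IsTameFamily (𝒦 : Finset (Set Y)) : Prop where
  isTame : ∀ K ∈ 𝒦, IsTame K
  disjoint : (𝒦 : Set (Set Y)).PairwiseDisjoint id

lemma IsTameFamily.subset {𝒦 𝒦' : Finset (Set Y)} (h : IsTameFamily 𝒦) (hs : 𝒦' ⊆ 𝒦) :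
    IsTameFamily 𝒦' :=
  ⟨fun K hK => h.isTame K (hs hK), h.disjoint.subset (by exact_mod_cast hs)⟩

lemma isTameFamily_empty : IsTameFamily (∅ : Finset (Set Y)) :=
  ⟨by simp, by simp⟩

lemma IsTameFamily.isClosed_sUnion {𝒦 : Finset (Set Y)} (h : IsTameFamily 𝒦) :
    IsClosed (⋃₀ (𝒦 : Set (Set Y))) :=
  isClosed_sUnion_finset fun K hK => (h.isTame K hK).isClosed

variable [LocallyConnectedSpace Y] [ConnectedSpace Y]

/-- In genus zero, finitely many disjoint closed solid sets do not separate the space. A minimal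
counterexample, together with the components of the complement of its union, would be an
irreducible partition. -/
lemma isPreconnected_compl_sUnion_closed_solid (hg : genus Y = 0) (𝒟 : Finset (Set Y))
    (hne : ∀ D ∈ 𝒟, D.Nonempty) (hs : ∀ D ∈ 𝒟, IsClosed D ∧ IsSolidC D)
    (hd : (𝒟 : Set (Set Y)).PairwiseDisjoint id) : IsPreconnected (⋃₀ (𝒟 : Set (Set Y)))ᶜ := by
  induction 𝒟 using Finset.strongInduction with
  | H 𝒟 ih =>
  by_contra hcon
  have hFcl : IsClosed (⋃₀ (𝒟 : Set (Set Y))) :=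
    isClosed_sUnion_finset fun D hD => (hs D hD).1
  have hnemp : 𝒟.Nonempty := by
    by_contra h
    rw [Finset.not_nonempty_iff_eq_empty] at h
    subst h
    apply hcon
    simp [isPreconnected_univ]
  obtain ⟨D₀, hD₀⟩ := hnemp
  obtain ⟨p, hp⟩ := hne D₀ hD₀
  set F : Set Y := (⋃₀ (𝒟 : Set (Set Y)))ᶜ with hF
  have hFo : IsOpen F := hFcl.isOpen_compl
  have hpF : p ∉ F := fun h => h ⟨D₀, hD₀, hp⟩
  -- by minimality, the closure of each component of the complement meets each of the closed sets
  have hmeet : ∀ V ∈ components F, ∀ D ∈ 𝒟, (closure V ∩ D).Nonempty := by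
    intro V hV D hD
    by_contra hVD
    rw [not_nonempty_iff_eq_empty] at hVD
    have hpre := ih (𝒟.erase D) (Finset.erase_ssubset hD)
      (fun E hE => hne E (Finset.mem_of_mem_erase hE))
      (fun E hE => hs E (Finset.mem_of_mem_erase hE))
      (hd.subset (by simp))
    have hVo := isOpen_of_mem_components hFo hV
    have hsub : (⋃₀ ((𝒟.erase D : Finset (Set Y)) : Set (Set Y)))ᶜ ⊆ V := by
      refine hpre.subset_of_closure_inter_subset hVo ?_ ?_
      · obtain ⟨x, hx⟩ := nonempty_of_mem_components hV
        refine ⟨x, ?_, hx⟩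
        rintro ⟨E, hE, hxE⟩
        exact subset_of_mem_components hV hx ⟨E, Finset.mem_of_mem_erase hE, hxE⟩
      · rintro x ⟨hx, hxE⟩
        rcases closure_component_subset hFo hV hx with h | h
        · exact h
        · rw [hF, compl_compl] at h
          obtain ⟨E, hE, hxE'⟩ := h
          by_cases hED : E = D
          · exact absurd (hVD.subset ⟨hx, hED ▸ hxE'⟩) (notMem_empty x)
          · exact absurd ⟨E, Finset.mem_coe.2 (Finset.mem_erase.2 ⟨hED, hE⟩), hxE'⟩ hxE
    obtain ⟨x, hx⟩ := hne D hD
    refine subset_of_mem_components hV (hsub ?_) ⟨D, hD, hx⟩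
    rintro ⟨E, hE, hxE⟩
    have hED := Finset.mem_erase.1 (Finset.mem_coe.1 hE)
    exact (hd hED.2 hD hED.1).le_bot ⟨hxE, hx⟩
  have hconn : ∀ V ∈ components F, IsPreconnected (V ∪ ⋃₀ (𝒟 : Set (Set Y))) := by
    intro V hV
    obtain ⟨x, hx⟩ := nonempty_of_mem_components hV
    have : V ∪ ⋃₀ (𝒟 : Set (Set Y)) = ⋃₀ ((fun D => V ∪ D) '' (𝒟 : Set (Set Y))) := by
      ext y
      constructor
      · rintro (h | ⟨D, hD, hy⟩)
        · exact ⟨_, ⟨D₀, hD₀, rfl⟩, Or.inl h⟩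
        · exact ⟨_, ⟨D, hD, rfl⟩, Or.inr hy⟩
      · rintro ⟨_, ⟨D, hD, rfl⟩, h | h⟩
        · exact Or.inl h
        · exact Or.inr ⟨D, hD, h⟩
    rw [this]
    refine isPreconnected_sUnion x _ ?_ ?_
    · rintro _ ⟨D, hD, rfl⟩
      exact Or.inl hx
    · rintro _ ⟨D, hD, rfl⟩
      exact isPreconnected_union_of_closure (isPreconnected_of_mem_components hV) (hs D hD).2.1
        (hmeet V hV D hD)
  have hsolid : ∀ V ∈ components F, IsSolidC V := by
    intro V hV
    refine ⟨isPreconnected_of_mem_components hV, ?_⟩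
    have hother : ∃ W ∈ components F, W ≠ V := by
      by_contra hall
      push Not at hall
      apply hcon
      have : F = V := by
        refine subset_antisymm ?_ (subset_of_mem_components hV)
        conv_lhs => rw [← sUnion_components F]
        exact sUnion_subset fun W hW => (hall W hW).subset
      rw [this]
      exact isPreconnected_of_mem_components hV
    obtain ⟨W₀, hW₀, hWV₀⟩ := hother
    have : Vᶜ = ⋃₀ ((fun W => W ∪ ⋃₀ (𝒟 : Set (Set Y))) '' (components F \ {V})) := by
      ext x
      constructor
      · intro hx
        by_cases hxF : x ∈ F
        · refine ⟨_, ⟨connectedComponentIn F x, ⟨⟨x, hxF, rfl⟩, ?_⟩, rfl⟩,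
            Or.inl (mem_connectedComponentIn hxF)⟩
          rintro rfl
          exact hx (mem_connectedComponentIn hxF)
        · exact ⟨_, ⟨W₀, ⟨hW₀, hWV₀⟩, rfl⟩, Or.inr (notMem_compl_iff.1 hxF)⟩
      · rintro ⟨_, ⟨W, ⟨hW, hWV⟩, rfl⟩, h | h⟩ hxV
        · exact hWV (eq_of_mem_components hW hV ⟨x, h, hxV⟩)
        · exact subset_of_mem_components hV hxV h
    rw [this]
    refine isPreconnected_sUnion p _ ?_ ?_
    · rintro _ ⟨W, -, rfl⟩
      exact Or.inr ⟨D₀, hD₀, hp⟩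
    · rintro _ ⟨W, hW, rfl⟩
      exact hconn W hW.1
  have hclosed : {A ∈ (𝒟 : Set (Set Y)) ∪ components F | IsClosed A} = 𝒟 := by
    ext A
    constructor
    · rintro ⟨hA | hA, hAc⟩
      · exact hA
      · have := IsClopen.eq_univ ⟨hAc, isOpen_of_mem_components hFo hA⟩
          (nonempty_of_mem_components hA)
        exact absurd (subset_of_mem_components hA (this ▸ mem_univ p)) hpF
    · intro hA
      exact ⟨Or.inl hA, (hs A hA).1⟩
  refine not_isIrreduciblePartition_of_genus_eq_zero hg ((𝒟 : Set (Set Y)) ∪ components F) ?_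
  refine { nonempty := ?_, solid := ?_, open_or_closed := ?_, disjoint := ?_, cover := ?_,
           finite_closed := ?_, two_le_order := ?_, connected_compl := ?_ }
  · rintro A (hA | hA)
    · exact hne A hA
    · exact nonempty_of_mem_components hA
  · rintro A (hA | hA)
    · exact (hs A hA).2
    · exact hsolid A hA
  · rintro A (hA | hA)
    · exact Or.inr (hs A hA).1
    · exact Or.inl (isOpen_of_mem_components hFo hA)
  · have hcross : ∀ A ∈ (𝒟 : Set (Set Y)), ∀ B ∈ components F, Disjoint A B := fun A hA B hB =>
      disjoint_left.2 fun x hx hxB => subset_of_mem_components hB hxB ⟨A, hA, hx⟩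
    rintro A (hA | hA) B (hB | hB) hAB
    · exact hd hA hB hAB
    · exact hcross A hA B hB
    · exact (hcross B hB A hA).symm
    · exact pairwiseDisjoint_components F hA hB hAB
  · rw [sUnion_union, sUnion_components, hF, union_compl_self]
  · rw [hclosed]
    exact 𝒟.finite_toSet
  · rw [order, hclosed, ncard_coe_finset]
    by_contra hlt
    have h1 : 𝒟.card = 1 := by
      have := Finset.card_pos.2 ⟨D₀, hD₀⟩
      omega
    obtain ⟨D, rfl⟩ := Finset.card_eq_one.1 h1
    apply hcon
    simpa [hF] using (hs D (by simp)).2.2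
  · intro Q hQ
    rw [hclosed] at hQ
    lift Q to Finset (Set Y) using 𝒟.finite_toSet.subset hQ.subset
    have hQ' : Q ⊂ 𝒟 := by exact_mod_cast hQ
    exact ih Q hQ' (fun D hD => hne D (hQ'.subset hD)) (fun D hD => hs D (hQ'.subset hD))
      (hd.subset hQ.subset)

variable [CompactSpace Y] [T2Space Y]

/-- In genus zero, finitely many disjoint open solid sets do not separate the space: a separation
of the complement would persist after shrinking the open sets to suitable closed solid sets. -/
lemma isPreconnected_compl_sUnion_open_solid (hg : genus Y = 0) (ℬ : Finset (Set Y))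
    (hs : ∀ B ∈ ℬ, IsOpen B ∧ IsSolidC B)
    (hd : (ℬ : Set (Set Y)).PairwiseDisjoint id) : IsPreconnected (⋃₀ (ℬ : Set (Set Y)))ᶜ := by
  classical
  have hop : IsOpen (⋃₀ (ℬ : Set (Set Y))) := isOpen_sUnion fun B hB => (hs B hB).1
  rw [isPreconnected_iff_subset_of_fully_disjoint_closed hop.isClosed_compl]
  intro u v hu hv huv hdis
  obtain ⟨V₁, V₂, hV₁, hV₂, huV, hvV, hVV⟩ := normal_separation hu hv hdis
  have hD : ∀ B ∈ ℬ, ∃ D, (IsClosed D ∧ IsSolidC D) ∧ (V₁ ∪ V₂)ᶜ ∩ B ⊆ D ∧ D ⊆ B := by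
    intro B hB
    refine exists_closed_solid_between (hs B hB).1 (hs B hB).2 ?_ inter_subset_right
    have : (V₁ ∪ V₂)ᶜ ∩ B = (V₁ ∪ V₂ ∪ ⋃₀ ((ℬ : Set (Set Y)) \ {B}))ᶜ := by
      ext x
      constructor
      · rintro ⟨hx, hxB⟩ (h | ⟨C, hC, hxC⟩)
        · exact hx h
        · exact (hd hB hC.1 (fun h => hC.2 h.symm)).le_bot ⟨hxB, hxC⟩
      · intro hx
        refine ⟨fun h => hx (Or.inl h), ?_⟩
        by_contra hxB
        have hxB' : x ∈ ⋃₀ (ℬ : Set (Set Y)) := by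
          by_contra hxU
          rcases huv hxU with h | h
          · exact hx (Or.inl (Or.inl (huV h)))
          · exact hx (Or.inl (Or.inr (hvV h)))
        obtain ⟨C, hC, hxC⟩ := hxB'
        exact hx (Or.inr ⟨C, ⟨hC, fun h => hxB (h ▸ hxC)⟩, hxC⟩)
    rw [this]
    exact ((hV₁.union hV₂).union (isOpen_sUnion fun C hC => (hs C hC.1).1)).isClosed_compl
  choose! D hDs hDsub hDB using hD
  have hpre := isPreconnected_compl_sUnion_closed_solid hg ((ℬ.image D).filter Set.Nonempty)
    (fun E hE => (Finset.mem_filter.1 hE).2) (by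
      intro E hE
      obtain ⟨B, hB, rfl⟩ := Finset.mem_image.1 (Finset.mem_filter.1 hE).1
      exact hDs B hB) (by
      intro E hE E' hE' hne
      obtain ⟨B, hB, rfl⟩ := Finset.mem_image.1 (Finset.mem_filter.1 hE).1
      obtain ⟨B', hB', rfl⟩ := Finset.mem_image.1 (Finset.mem_filter.1 hE').1
      exact (hd hB hB' (fun h => hne (h ▸ rfl))).mono (hDB B hB) (hDB B' hB'))
  set F := ⋃₀ (((ℬ.image D).filter Set.Nonempty : Finset (Set Y)) : Set (Set Y)) with hF
  have hFB : F ⊆ ⋃₀ (ℬ : Set (Set Y)) := by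
    rintro x ⟨E, hE, hx⟩
    obtain ⟨B, hB, rfl⟩ := Finset.mem_image.1 (Finset.mem_filter.1 hE).1
    exact ⟨B, hB, hDB B hB hx⟩
  have hcov : Fᶜ ⊆ V₁ ∪ V₂ := by
    intro x hx
    by_contra hxV
    by_cases hxU : x ∈ ⋃₀ (ℬ : Set (Set Y))
    · obtain ⟨B, hB, hxB⟩ := hxU
      have hxD := hDsub B hB ⟨hxV, hxB⟩
      exact hx ⟨D B, Finset.mem_coe.2 (Finset.mem_filter.2
        ⟨Finset.mem_image_of_mem D hB, x, hxD⟩), hxD⟩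
    · rcases huv hxU with h | h
      · exact hxV (Or.inl (huV h))
      · exact hxV (Or.inr (hvV h))
  rcases hpre.subset_or_subset hV₁ hV₂ hVV hcov with h | h
  · left
    intro x hx
    rcases huv hx with h1 | h1
    · exact h1
    · exact (hVV.le_bot ⟨h (compl_subset_compl.2 hFB hx), hvV h1⟩).elim
  · right
    intro x hx
    rcases huv hx with h1 | h1
    · exact (hVV.le_bot ⟨huV h1, h (compl_subset_compl.2 hFB hx)⟩).elim
    · exact h1

lemma isTame_compl_sUnion (hg : genus Y = 0) (ℬ : Finset (Set Y))
    (hs : ∀ B ∈ ℬ, IsOpen B ∧ IsSolidC B) (hn : ∀ B ∈ ℬ, B.Nonempty)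
    (hd : (ℬ : Set (Set Y)).PairwiseDisjoint id) (hne : (⋃₀ (ℬ : Set (Set Y)))ᶜ.Nonempty) :
    IsTame (⋃₀ (ℬ : Set (Set Y)))ᶜ where
  isClosed := (isOpen_sUnion fun B hB => (hs B hB).1).isClosed_compl
  isPreconnected := isPreconnected_compl_sUnion_open_solid hg ℬ hs hd
  nonempty := hne
  finite := by
    rw [compl_compl, components_sUnion (fun B hB => (hs B hB).1) (fun B hB => (hs B hB).2.1) hn hd]
    exact ℬ.finite_toSet

/-- Filling in the components of the complement that lie in a given open neighbourhood makes a
continuum tame, as all but finitely many of them do. -/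
lemma exists_tame_between_of_continuum (hg : genus Y = 0) {K U : Set Y} (hK : IsClosed K)
    (hc : IsPreconnected K) (hne : K.Nonempty) (hU : IsOpen U) (hKU : K ⊆ U) :
    ∃ L, IsTame L ∧ K ⊆ L ∧ L ⊆ U := by
  have hcov : Uᶜ ⊆ ⋃₀ components Kᶜ := by
    rw [sUnion_components]
    exact compl_subset_compl.2 hKU
  obtain ⟨T, hT, hTcov⟩ := exists_finset_subcover_sUnion hU.isClosed_compl.isCompact
    (fun V hV => isOpen_of_mem_components hK.isOpen_compl hV) hcov
  have hKL : K ⊆ (⋃₀ (T : Set (Set Y)))ᶜ := by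
    rintro x hx ⟨V, hV, hxV⟩
    exact subset_of_mem_components (hT hV) hxV hx
  refine ⟨(⋃₀ (T : Set (Set Y)))ᶜ, ?_, hKL, compl_subset_comm.1 hTcov⟩
  exact isTame_compl_sUnion hg T
    (fun V hV => ⟨isOpen_of_mem_components hK.isOpen_compl (hT hV),
      isSolidC_component hK hc hne (hT hV)⟩)
    (fun V hV => nonempty_of_mem_components (hT hV))
    ((pairwiseDisjoint_components _).subset hT) (hne.mono hKL)

/-- In genus zero, the unions of finitely many disjoint tame continua are cofinal among the closed
subsets of an open set. -/
lemma exists_tameFamily_between (hg : genus Y = 0) {C U : Set Y} (hC : IsClosed C) (hU : IsOpen U)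
    (hCU : C ⊆ U) : ∃ 𝒦 : Finset (Set Y), IsTameFamily 𝒦 ∧ C ⊆ ⋃₀ (𝒦 : Set (Set Y)) ∧
      ⋃₀ (𝒦 : Set (Set Y)) ⊆ U := by
  classical
  obtain ⟨T, hT, hTcov⟩ := exists_finset_subcover_sUnion hC.isCompact
    (fun V hV => isOpen_of_mem_components hU hV) (hCU.trans (sUnion_components U).symm.subset)
  have hV : ∀ V ∈ T, ∃ L, IsTame L ∧ C ∩ V ⊆ L ∧ L ⊆ V := by
    intro V hV
    have hVo := isOpen_of_mem_components hU (hT hV)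
    have hVne := nonempty_of_mem_components (hT hV)
    have hCV : C ∩ V = C \ ⋃₀ ((T : Set (Set Y)) \ {V}) := by
      ext x
      constructor
      · rintro ⟨hx, hxV⟩
        refine ⟨hx, ?_⟩
        rintro ⟨W, hW, hxW⟩
        exact hW.2 (eq_of_mem_components (hT hW.1) (hT hV) ⟨x, hxW, hxV⟩)
      · rintro ⟨hx, hx'⟩
        refine ⟨hx, ?_⟩
        obtain ⟨W, hW, hxW⟩ := hTcov hx
        by_cases h : W = V
        · exact h ▸ hxW
        · exact absurd ⟨W, ⟨hW, h⟩, hxW⟩ hx'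
    have hcl : IsClosed (C ∩ V) := by
      rw [hCV]
      exact hC.sdiff (isOpen_sUnion fun W hW => isOpen_of_mem_components hU (hT hW.1))
    obtain ⟨y, hy⟩ := hVne
    obtain ⟨D, hD, hDc, hCD, hDV⟩ := exists_continuum_between hVo
      (isPreconnected_of_mem_components (hT hV)) (hcl.union (isClosed_singleton (x := y))).isCompact
      (union_subset inter_subset_right (singleton_subset_iff.2 hy))
    obtain ⟨L, hL, hDL, hLV⟩ := exists_tame_between_of_continuum hg hD hDc
      ⟨y, hCD (Or.inr rfl)⟩ hVo hDV
    exact ⟨L, hL, subset_union_left.trans (hCD.trans hDL), hLV⟩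
  choose! L hL hCL hLV using hV
  refine ⟨T.image L, ⟨?_, ?_⟩, ?_, ?_⟩
  · intro K hK
    obtain ⟨V, hV, rfl⟩ := Finset.mem_image.1 hK
    exact hL V hV
  · intro K hK K' hK' hne
    obtain ⟨V, hV, rfl⟩ := Finset.mem_image.1 (Finset.mem_coe.1 hK)
    obtain ⟨V', hV', rfl⟩ := Finset.mem_image.1 (Finset.mem_coe.1 hK')
    exact (pairwiseDisjoint_components U (hT hV) (hT hV') (fun h => hne (h ▸ rfl))).mono
      (hLV V hV) (hLV V' hV')
  · intro x hx
    obtain ⟨V, hV, hxV⟩ := hTcov hx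
    exact ⟨L V, Finset.mem_coe.2 (Finset.mem_image_of_mem L hV), hCL V hV ⟨hx, hxV⟩⟩
  · rintro x ⟨K, hK, hx⟩
    obtain ⟨V, hV, rfl⟩ := Finset.mem_image.1 (Finset.mem_coe.1 hK)
    exact subset_of_mem_components (hT hV) (hLV V hV hx)

end GenusZero

/-! ### Branches of tame continua -/

section Family

variable {Y : Type*}

/-- The family of closed solid sets that bounds, within a branch `B` of a tame continuum, the
complement of a given family `𝒟`: the set `Bᶜ` and those members of `𝒟` that lie in `B`. -/
noncomputable def branchFamily (𝒟 : Finset (Set Y)) (B : Set Y) : Finset (Set Y) :=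
  open scoped Classical in insert Bᶜ {D ∈ 𝒟 | D ⊆ B}

lemma disjoint_branchFamily {B L : Set Y} {𝒟 : Finset (Set Y)} (hLB : L ⊆ B)
    (hL : ∀ D ∈ 𝒟, Disjoint L D) : ∀ D ∈ branchFamily 𝒟 B, Disjoint L D := by
  intro D hD
  rcases (by simpa [branchFamily] using hD : D = Bᶜ ∨ D ∈ 𝒟 ∧ D ⊆ B) with rfl | hD
  · exact disjoint_compl_right.mono_left hLB
  · exact hL D hD.1

lemma sum_branchFamily {B : Set Y} {𝒟 : Finset (Set Y)} (h : ∀ D ∈ 𝒟, D.Nonempty)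
    (f : Set Y → ℝ) [DecidablePred (· ⊆ B)] :
    ∑ D ∈ branchFamily 𝒟 B, f D = f Bᶜ + ∑ D ∈ 𝒟 with D ⊆ B, f D := by
  classical
  have hB : Bᶜ ∉ ({D ∈ 𝒟 | D ⊆ B} : Finset (Set Y)) := by
    rw [Finset.mem_filter]
    rintro ⟨h1, h2⟩
    obtain ⟨x, hx⟩ := h _ h1
    exact hx (h2 hx)
  rw [← Finset.sum_insert hB, branchFamily]
  congr!

variable [TopologicalSpace Y]

/-- A finite family of pairwise disjoint nonempty closed solid sets. -/
structure IsClosedSolidFamily (𝒟 : Finset (Set Y)) : Prop where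
  nonempty : ∀ D ∈ 𝒟, D.Nonempty
  isClosed : ∀ D ∈ 𝒟, IsClosed D
  isSolidC : ∀ D ∈ 𝒟, IsSolidC D
  disjoint : (𝒟 : Set (Set Y)).PairwiseDisjoint id

lemma isClosedSolidFamily_empty : IsClosedSolidFamily (∅ : Finset (Set Y)) :=
  ⟨by simp, by simp, by simp, by simp⟩

lemma isClosedSolidFamily_singleton {D : Set Y} (hne : D.Nonempty) (hD : IsClosed D)
    (hs : IsSolidC D) : IsClosedSolidFamily {D} :=
  ⟨by simpa using hne, by simpa using hD, by simpa using hs, by simp⟩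

/-- The open solid sets that form the complement of a tame continuum. -/
noncomputable def IsTame.branches {K : Set Y} (hK : IsTame K) : Finset (Set Y) :=
  hK.finite.toFinset

lemma IsTame.mem_branches {K B : Set Y} (hK : IsTame K) :
    B ∈ hK.branches ↔ B ∈ components Kᶜ :=
  Set.Finite.mem_toFinset _

lemma IsTame.branch_disjoint {K B : Set Y} (hK : IsTame K) (hB : B ∈ hK.branches) :
    Disjoint K B :=
  disjoint_left.2 fun _ hx hxB => subset_of_mem_components (hK.mem_branches.1 hB) hxB hx

/-- Connected sets that avoid a tame continuum are sorted by its branches. -/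
lemma IsTame.sum_branches {K : Set Y} (hK : IsTame K) {𝒮 : Finset (Set Y)}
    (hne : ∀ S ∈ 𝒮, S.Nonempty) (hc : ∀ S ∈ 𝒮, IsPreconnected S)
    (hd : ∀ S ∈ 𝒮, Disjoint K S) (f : Set Y → ℝ) [∀ B : Set Y, DecidablePred (· ⊆ B)] :
    ∑ B ∈ hK.branches, ∑ S ∈ 𝒮 with S ⊆ B, f S = ∑ S ∈ 𝒮, f S := by
  classical
  rw [← Finset.sum_biUnion]
  · congr 1
    ext S
    simp only [Finset.mem_biUnion, Finset.mem_filter]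
    constructor
    · rintro ⟨B, -, h, -⟩
      exact h
    · intro hS
      obtain ⟨B, hB, hSB⟩ := exists_subset_mem_components (hc S hS) (hne S hS)
        (hd S hS).subset_compl_left
      exact ⟨B, hK.mem_branches.2 hB, hS, hSB⟩
  · intro B hB B' hB' hBB
    refine Finset.disjoint_left.2 fun S hS hS' => ?_
    obtain ⟨hS, h1⟩ := Finset.mem_filter.1 hS
    have h2 := (Finset.mem_filter.1 hS').2
    obtain ⟨x, hx⟩ := hne S hS
    exact hBB (eq_of_mem_components (hK.mem_branches.1 hB) (hK.mem_branches.1 hB')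
      ⟨x, h1 hx, h2 hx⟩)

variable [LocallyConnectedSpace Y]

lemma IsTame.isOpen_branch {K B : Set Y} (hK : IsTame K) (hB : B ∈ hK.branches) : IsOpen B :=
  isOpen_of_mem_components hK.isClosed.isOpen_compl (hK.mem_branches.1 hB)

variable [PreconnectedSpace Y]

lemma IsTame.isSolidC_branch {K B : Set Y} (hK : IsTame K) (hB : B ∈ hK.branches) : IsSolidC B :=
  isSolidC_component hK.isClosed hK.isPreconnected hK.nonempty (hK.mem_branches.1 hB)

lemma IsTame.isClosedSolidFamily_branchFamily {K B : Set Y} (hK : IsTame K)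
    (hB : B ∈ hK.branches) {𝒟 : Finset (Set Y)} (h : IsClosedSolidFamily 𝒟) :
    IsClosedSolidFamily (branchFamily 𝒟 B) := by
  have hmem : ∀ D, D ∈ branchFamily 𝒟 B ↔ D = Bᶜ ∨ D ∈ 𝒟 ∧ D ⊆ B := by simp [branchFamily]
  refine ⟨?_, ?_, ?_, ?_⟩
  · intro D hD
    rcases (hmem D).1 hD with rfl | hD
    · exact hK.nonempty.mono (hK.branch_disjoint hB).subset_compl_right
    · exact h.nonempty D hD.1
  · intro D hD
    rcases (hmem D).1 hD with rfl | hD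
    · exact (hK.isOpen_branch hB).isClosed_compl
    · exact h.isClosed D hD.1
  · intro D hD
    rcases (hmem D).1 hD with rfl | hD
    · exact (hK.isSolidC_branch hB).compl
    · exact h.isSolidC D hD.1
  · intro D hD E hE hne
    rcases (hmem D).1 hD with rfl | hD <;> rcases (hmem E).1 hE with rfl | hE
    · exact absurd rfl hne
    · exact disjoint_compl_left.mono_right hE.2
    · exact disjoint_compl_right.mono_left hD.2
    · exact h.disjoint hD.1 hE.1 hne

end Family

/-! ### Values on continua and on open sets -/

section Values

variable {Y : Type*} [TopologicalSpace Y] {ν : Set Y → ℝ≥0}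

lemma IsSolidSetFunctionC.add_compl (hν : IsSolidSetFunctionC ν) {A : Set Y}
    (h : IsOpen A ∨ IsClosed A) (hs : IsSolidC A) : (ν A : ℝ) + ν Aᶜ = ν univ := by
  exact_mod_cast hν.additive_trivial A h hs

lemma IsSolidSetFunctionC.empty [PreconnectedSpace Y] (hν : IsSolidSetFunctionC ν) : ν ∅ = 0 := by
  have := hν.additive_trivial ∅ (Or.inl isOpen_empty) isSolidC_empty
  rw [compl_empty] at this
  simpa using this

lemma IsSolidSetFunctionC.mono (hν : IsSolidSetFunctionC ν) {C D : Set Y} (hC : IsClosed C)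
    (hCs : IsSolidC C) (hD : IsClosed D) (hDs : IsSolidC D) (h : C ⊆ D) : ν C ≤ ν D := by
  have := hν.superadditive 1 (fun _ => C) D (fun _ => ⟨hC, hCs⟩) ⟨hD, hDs⟩
    (fun i j hij => absurd (Subsingleton.elim i j) hij) (by simpa using h)
  simpa using this

lemma IsSolidSetFunctionC.sum_le [PreconnectedSpace Y] (hν : IsSolidSetFunctionC ν)
    {𝒟 : Finset (Set Y)} (h : IsClosedSolidFamily 𝒟) : ∑ D ∈ 𝒟, (ν D : ℝ) ≤ ν univ := by
  have := hν.superadditive 𝒟.card (fun i => (𝒟.equivFin.symm i : Set Y)) univ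
    (fun i => ⟨h.isClosed _ (𝒟.equivFin.symm i).2, h.isSolidC _ (𝒟.equivFin.symm i).2⟩)
    ⟨isClosed_univ, by simpa using (isSolidC_empty (Y := Y)).compl⟩
    (fun i j hij => h.disjoint (𝒟.equivFin.symm i).2 (𝒟.equivFin.symm j).2
      (fun he => hij (𝒟.equivFin.symm.injective (Subtype.ext he)))) (subset_univ _)
  rw [Equiv.sum_comp 𝒟.equivFin.symm (fun D => ν (D : Set Y)),
    Finset.sum_coe_sort 𝒟 (fun D => ν D)] at this
  exact_mod_cast this

/-- Outer regularity on closed solid sets, which is inner regularity on the complements. -/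
lemma IsSolidSetFunctionC.exists_open_solid [CompactSpace Y] [T2Space Y] [LocallyConnectedSpace Y]
    [PreconnectedSpace Y] (hν : IsSolidSetFunctionC ν) {D V : Set Y} (hD : IsClosed D)
    (hDs : IsSolidC D) (hV : IsOpen V) (hDV : D ⊆ V) {ε : ℝ} (hε : 0 < ε) :
    ∃ O, (IsOpen O ∧ IsSolidC O) ∧ D ⊆ O ∧ O ⊆ V ∧ (ν O : ℝ) ≤ ν D + ε := by
  obtain ⟨K, ⟨⟨hK, hKs⟩, hKD⟩, hKε⟩ : ∃ K, ((IsClosed K ∧ IsSolidC K) ∧ K ⊆ Dᶜ) ∧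
      (ν Dᶜ : ℝ) ≤ ν K + ε := by
    by_contra! hcon
    have h1 := (hν.inner_regular Dᶜ hD.isOpen_compl hDs.compl).2
      (show (ν Dᶜ - ε.toNNReal) ∈ _ from ?_)
    · have h0 : ν Dᶜ ≠ 0 := by
        intro h0
        have := hcon ∅ ⟨⟨isClosed_empty, isSolidC_empty⟩, empty_subset _⟩
        rw [h0] at this
        have h2 : (0 : ℝ) ≤ ν ∅ := (ν ∅).2
        simp only [NNReal.coe_zero] at this
        linarith
      exact absurd h1 (not_le.2 (tsub_lt_self (pos_iff_ne_zero.2 h0) (by simpa using hε)))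
    · rintro _ ⟨K, hK, rfl⟩
      have := hcon K hK
      rw [le_tsub_iff_right]
      · rw [← NNReal.coe_le_coe, NNReal.coe_add, Real.coe_toNNReal _ hε.le]
        exact this.le
      · rw [← NNReal.coe_le_coe, Real.coe_toNNReal _ hε.le]
        have h2 : (0 : ℝ) ≤ ν K := (ν K).2
        linarith
  obtain ⟨E, ⟨hE, hEs⟩, hKE, hED⟩ := exists_closed_solid_between hD.isOpen_compl hDs.compl
    (hK.union hV.isClosed_compl) (union_subset hKD (compl_subset_compl.2 hDV))
  refine ⟨Eᶜ, ⟨hE.isOpen_compl, hEs.compl⟩, subset_compl_comm.1 hED,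
    compl_subset_comm.1 (subset_union_right.trans hKE), ?_⟩
  have h1 := hν.add_compl (Or.inr hE) hEs
  have h2 := hν.add_compl (Or.inr hD) hDs
  have h3 : (ν K : ℝ) ≤ ν E := by
    exact_mod_cast hν.mono hK hKs hE hEs (subset_union_left.trans hKE)
  linarith

/-- The value on a tame continuum that additivity forces on an extension of `ν`: the total mass
minus the masses of the components of the complement. -/
noncomputable def continuumValue (ν : Set Y → ℝ≥0) (K : Set Y) : ℝ :=
  ν univ - ∑ᶠ B ∈ components Kᶜ, (ν B : ℝ)

lemma IsTame.continuumValue_eq {K : Set Y} (hK : IsTame K) :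
    continuumValue ν K = ν univ - ∑ B ∈ hK.branches, (ν B : ℝ) := by
  rw [continuumValue, finsum_mem_eq_finite_toFinset_sum _ hK.finite, IsTame.branches]

/-- Disjoint tame continua and closed solid sets together carry at most the total mass. -/
lemma IsSolidSetFunctionC.sum_continuumValue_add_le [LocallyConnectedSpace Y]
    [PreconnectedSpace Y] (hν : IsSolidSetFunctionC ν) {𝒦 𝒟 : Finset (Set Y)}
    (h𝒦 : IsTameFamily 𝒦) (h𝒟 : IsClosedSolidFamily 𝒟)
    (hd : ∀ K ∈ 𝒦, ∀ D ∈ 𝒟, Disjoint K D) :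
    ∑ K ∈ 𝒦, continuumValue ν K + ∑ D ∈ 𝒟, (ν D : ℝ) ≤ ν univ := by
  classical
  induction 𝒦 using Finset.strongInduction generalizing 𝒟 with
  | H 𝒦 ih =>
  rcases 𝒦.eq_empty_or_nonempty with rfl | ⟨K, hK𝒦⟩
  · simpa using hν.sum_le h𝒟
  have hK := h𝒦.isTame K hK𝒦
  have hstep : ∀ B ∈ hK.branches, ∑ L ∈ 𝒦.erase K with L ⊆ B, continuumValue ν L +
      ∑ D ∈ 𝒟 with D ⊆ B, (ν D : ℝ) ≤ ν B := by
    intro B hB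
    have hsub : ({L ∈ 𝒦.erase K | L ⊆ B} : Finset (Set Y)) ⊂ 𝒦 :=
      (Finset.filter_subset _ _).trans_ssubset (Finset.erase_ssubset hK𝒦)
    have h1 := ih _ hsub (h𝒦.subset hsub.subset) (hK.isClosedSolidFamily_branchFamily hB h𝒟)
      (fun L hL => disjoint_branchFamily (Finset.mem_filter.1 hL).2
        (hd L (hsub.subset hL)))
    rw [sum_branchFamily h𝒟.nonempty] at h1
    have h2 := hν.add_compl (Or.inl (hK.isOpen_branch hB)) (hK.isSolidC_branch hB)
    linarith
  have h1 := Finset.sum_le_sum hstep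
  rw [Finset.sum_add_distrib, hK.sum_branches, hK.sum_branches] at h1
  · have h2 := hK.continuumValue_eq (ν := ν)
    rw [← Finset.add_sum_erase _ _ hK𝒦]
    linarith
  · exact h𝒟.nonempty
  · exact fun D hD => (h𝒟.isSolidC D hD).1
  · exact hd K hK𝒦
  · exact fun L hL => (h𝒦.isTame L (Finset.mem_of_mem_erase hL)).nonempty
  · exact fun L hL => (h𝒦.isTame L (Finset.mem_of_mem_erase hL)).isPreconnected
  · exact fun L hL => h𝒦.disjoint hK𝒦 (Finset.mem_of_mem_erase hL)
      (Finset.ne_of_mem_erase hL).symm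

/-- The value on an open set: the supremum of the total values of finite families of disjoint tame
continua inside it. -/
noncomputable def openValue (ν : Set Y → ℝ≥0) (U : Set Y) : ℝ :=
  sSup {r | ∃ 𝒦 : Finset (Set Y), IsTameFamily 𝒦 ∧ ⋃₀ (𝒦 : Set (Set Y)) ⊆ U ∧
    r = ∑ K ∈ 𝒦, continuumValue ν K}

lemma openValue_le {U : Set Y} {r : ℝ} (h : ∀ 𝒦 : Finset (Set Y), IsTameFamily 𝒦 →
    ⋃₀ (𝒦 : Set (Set Y)) ⊆ U → ∑ K ∈ 𝒦, continuumValue ν K ≤ r) : openValue ν U ≤ r := by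
  refine csSup_le ⟨0, ∅, isTameFamily_empty, by simp, by simp⟩ ?_
  rintro _ ⟨𝒦, h𝒦, hU, rfl⟩
  exact h 𝒦 h𝒦 hU

lemma exists_lt_of_lt_openValue {U : Set Y} {r : ℝ} (h : r < openValue ν U) :
    ∃ 𝒦 : Finset (Set Y), IsTameFamily 𝒦 ∧ ⋃₀ (𝒦 : Set (Set Y)) ⊆ U ∧
      r < ∑ K ∈ 𝒦, continuumValue ν K := by
  by_contra! hcon
  exact absurd (openValue_le hcon) (not_le.2 h)

/-- The topological measure on all open and all closed subsets of the compact space. -/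
noncomputable def extension (ν : Set Y → ℝ≥0) (A : Set Y) : ℝ :=
  sInf (openValue ν '' {U | IsOpen U ∧ A ⊆ U})

lemma le_extension {A : Set Y} {r : ℝ} (h : ∀ U, IsOpen U → A ⊆ U → r ≤ openValue ν U) :
    r ≤ extension ν A := by
  refine le_csInf ⟨_, univ, ⟨isOpen_univ, subset_univ _⟩, rfl⟩ ?_
  rintro _ ⟨U, ⟨hU, hAU⟩, rfl⟩
  exact h U hU hAU

lemma exists_openValue_lt {A : Set Y} {r : ℝ} (h : extension ν A < r) :
    ∃ U, IsOpen U ∧ A ⊆ U ∧ openValue ν U < r := by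
  by_contra! hcon
  exact absurd (le_extension hcon) (not_le.2 h)

variable [LocallyConnectedSpace Y] [PreconnectedSpace Y]

lemma IsSolidSetFunctionC.le_openValue (hν : IsSolidSetFunctionC ν) {U : Set Y}
    {𝒦 : Finset (Set Y)} (h𝒦 : IsTameFamily 𝒦) (hU : ⋃₀ (𝒦 : Set (Set Y)) ⊆ U) :
    ∑ K ∈ 𝒦, continuumValue ν K ≤ openValue ν U := by
  refine le_csSup ⟨ν univ, ?_⟩ ⟨𝒦, h𝒦, hU, rfl⟩
  rintro _ ⟨𝒦, h𝒦, -, rfl⟩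
  simpa using hν.sum_continuumValue_add_le h𝒦 isClosedSolidFamily_empty (by simp)

lemma IsSolidSetFunctionC.openValue_mono (hν : IsSolidSetFunctionC ν) {U V : Set Y} (h : U ⊆ V) :
    openValue ν U ≤ openValue ν V :=
  openValue_le fun _ h𝒦 hU => hν.le_openValue h𝒦 (hU.trans h)

lemma IsSolidSetFunctionC.openValue_nonneg (hν : IsSolidSetFunctionC ν) (U : Set Y) :
    0 ≤ openValue ν U := by
  simpa using hν.le_openValue (U := U) isTameFamily_empty (by simp)

lemma IsSolidSetFunctionC.openValue_add_le (hν : IsSolidSetFunctionC ν) {U V : Set Y}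
    (h : Disjoint U V) : openValue ν U + openValue ν V ≤ openValue ν (U ∪ V) := by
  classical
  rw [← le_sub_iff_add_le]
  refine openValue_le fun 𝒦 h𝒦 hU => ?_
  rw [le_sub_comm]
  refine openValue_le fun ℒ hℒ hV => ?_
  rw [le_sub_iff_add_le']
  have hdis : ∀ K ∈ 𝒦, ∀ L ∈ ℒ, Disjoint K L := fun K hK L hL =>
    h.mono ((subset_sUnion_of_mem (Finset.mem_coe.2 hK)).trans hU)
      ((subset_sUnion_of_mem (Finset.mem_coe.2 hL)).trans hV)
  rw [← Finset.sum_union]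
  · refine hν.le_openValue ⟨?_, ?_⟩ ?_
    · intro K hK
      exact (Finset.mem_union.1 hK).elim (h𝒦.isTame K) (hℒ.isTame K)
    · intro K hK L hL hne
      rcases Finset.mem_union.1 (Finset.mem_coe.1 hK) with hK | hK <;>
        rcases Finset.mem_union.1 (Finset.mem_coe.1 hL) with hL | hL
      · exact h𝒦.disjoint hK hL hne
      · exact hdis K hK L hL
      · exact (hdis L hL K hK).symm
      · exact hℒ.disjoint hK hL hne
    · rw [Finset.coe_union, sUnion_union]
      exact union_subset_union hU hV
  · refine Finset.disjoint_left.2 fun K hK hK' => ?_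
    exact (h𝒦.isTame K hK).nonempty.ne_empty (disjoint_self.1 (hdis K hK K hK'))

lemma IsSolidSetFunctionC.openValue_union (hν : IsSolidSetFunctionC ν) {U V : Set Y}
    (hU : IsOpen U) (hV : IsOpen V) (h : Disjoint U V) :
    openValue ν (U ∪ V) = openValue ν U + openValue ν V := by
  classical
  refine le_antisymm (openValue_le fun 𝒦 h𝒦 hUV => ?_) (hν.openValue_add_le h)
  rw [← Finset.sum_filter_add_sum_filter_not 𝒦 (· ⊆ U)]
  refine add_le_add (hν.le_openValue (h𝒦.subset (Finset.filter_subset _ _)) ?_)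
    (hν.le_openValue (h𝒦.subset (Finset.filter_subset _ _)) ?_)
  · exact sUnion_subset fun K hK => (Finset.mem_filter.1 (Finset.mem_coe.1 hK)).2
  · refine sUnion_subset fun K hK => ?_
    obtain ⟨hK, hKU⟩ := Finset.mem_filter.1 (Finset.mem_coe.1 hK)
    exact ((h𝒦.isTame K hK).isPreconnected.subset_or_subset hU hV h
      ((subset_sUnion_of_mem (Finset.mem_coe.2 hK)).trans hUV)).resolve_left hKU

lemma IsSolidSetFunctionC.sum_openValue_le (hν : IsSolidSetFunctionC ν) (ℬ : Finset (Set Y))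
    (O : Set Y → Set Y) (h : (ℬ : Set (Set Y)).PairwiseDisjoint O) :
    ∑ B ∈ ℬ, openValue ν (O B) ≤ openValue ν (⋃ B ∈ ℬ, O B) := by
  classical
  induction ℬ using Finset.induction_on with
  | empty => simpa using hν.openValue_nonneg _
  | insert B ℬ hB ih =>
    rw [Finset.sum_insert hB, Finset.set_biUnion_insert]
    refine (add_le_add_right (ih (h.subset (by simp))) _).trans (hν.openValue_add_le ?_)
    rw [disjoint_iUnion₂_right]
    intro C hC
    exact h (by simp) (by simp [hC]) (fun hBC => hB (hBC ▸ hC))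

lemma IsSolidSetFunctionC.bddBelow_openValue (hν : IsSolidSetFunctionC ν) (s : Set (Set Y)) :
    BddBelow (openValue ν '' s) := by
  refine ⟨0, ?_⟩
  rintro _ ⟨U, -, rfl⟩
  exact hν.openValue_nonneg U

lemma IsSolidSetFunctionC.extension_le (hν : IsSolidSetFunctionC ν) {A U : Set Y} (hU : IsOpen U)
    (h : A ⊆ U) : extension ν A ≤ openValue ν U :=
  csInf_le (hν.bddBelow_openValue _) ⟨U, ⟨hU, h⟩, rfl⟩

lemma IsSolidSetFunctionC.extension_open (hν : IsSolidSetFunctionC ν) {U : Set Y}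
    (hU : IsOpen U) : extension ν U = openValue ν U :=
  le_antisymm (hν.extension_le hU subset_rfl) (le_extension fun _ _ h => hν.openValue_mono h)

lemma IsSolidSetFunctionC.extension_nonneg (hν : IsSolidSetFunctionC ν) (A : Set Y) :
    0 ≤ extension ν A :=
  le_extension fun U _ _ => hν.openValue_nonneg U

lemma IsSolidSetFunctionC.extension_mono (hν : IsSolidSetFunctionC ν) {A B : Set Y} (h : A ⊆ B) :
    extension ν A ≤ extension ν B :=
  le_extension fun _ hU hBU => hν.extension_le hU (h.trans hBU)

lemma IsSolidSetFunctionC.extension_union_open (hν : IsSolidSetFunctionC ν)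
    {A B : Set Y} (hA : IsOpen A) (hB : IsOpen B) (hAB : Disjoint A B) :
    extension ν (A ∪ B) = extension ν A + extension ν B := by
  rw [hν.extension_open hA, hν.extension_open hB, hν.extension_open (hA.union hB),
    hν.openValue_union hA hB hAB]

end Values

/-! ### The topological measure on the compactification -/

section Extension

variable {Y : Type*} [TopologicalSpace Y] {ν : Set Y → ℝ≥0}

lemma IsClosedSolidFamily.subset {𝒟 𝒟' : Finset (Set Y)} (h : IsClosedSolidFamily 𝒟)
    (hs : 𝒟' ⊆ 𝒟) : IsClosedSolidFamily 𝒟' :=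
  ⟨fun D hD => h.nonempty D (hs hD), fun D hD => h.isClosed D (hs hD),
    fun D hD => h.isSolidC D (hs hD), h.disjoint.subset (by exact_mod_cast hs)⟩

lemma continuumValue_compl_sUnion [LocallyConnectedSpace Y] {ℬ : Finset (Set Y)}
    (hs : ∀ B ∈ ℬ, IsOpen B ∧ IsSolidC B) (hn : ∀ B ∈ ℬ, B.Nonempty)
    (hd : (ℬ : Set (Set Y)).PairwiseDisjoint id) :
    continuumValue ν (⋃₀ (ℬ : Set (Set Y)))ᶜ = ν univ - ∑ B ∈ ℬ, (ν B : ℝ) := by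
  rw [continuumValue, compl_compl, components_sUnion (fun B hB => (hs B hB).1)
    (fun B hB => (hs B hB).2.1) hn hd, finsum_mem_coe_finset]

variable [CompactSpace Y] [T2Space Y] [LocallyConnectedSpace Y]

lemma IsSolidSetFunctionC.exists_disjoint_open_solid [PreconnectedSpace Y]
    (hν : IsSolidSetFunctionC ν)
    {𝒟 : Finset (Set Y)} (h : IsClosedSolidFamily 𝒟) {V : Set Y} (hV : IsOpen V)
    (hDV : ⋃₀ (𝒟 : Set (Set Y)) ⊆ V) {ε : ℝ} (hε : 0 < ε) :
    ∃ O : Set Y → Set Y, (∀ D ∈ 𝒟, (IsOpen (O D) ∧ IsSolidC (O D)) ∧ D ⊆ O D ∧ O D ⊆ V ∧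
      (ν (O D) : ℝ) ≤ ν D + ε) ∧ (𝒟 : Set (Set Y)).PairwiseDisjoint O := by
  classical
  induction 𝒟 using Finset.induction_on generalizing V with
  | empty => exact ⟨id, by simp, by simp⟩
  | insert D 𝒟 hD ih =>
    rw [Finset.coe_insert, sUnion_insert, union_subset_iff] at hDV
    have h' := h.subset (Finset.subset_insert D 𝒟)
    have hdis : Disjoint D (⋃₀ (𝒟 : Set (Set Y))) := by
      rw [disjoint_sUnion_right]
      intro E hE
      exact h.disjoint (by simp) (by simp [Finset.mem_coe.1 hE])
        (fun hDE => hD (hDE ▸ Finset.mem_coe.1 hE))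
    obtain ⟨V₁, V₂, hV₁, hV₂, hDV₁, hV₂', hVV⟩ := normal_separation
      (h.isClosed D (by simp)) (isClosed_sUnion_finset h'.isClosed) hdis
    obtain ⟨O, hO, hOd⟩ := ih h' (hV.inter hV₂) (subset_inter hDV.2 hV₂')
    obtain ⟨W, hW, hDW, hWV, hWε⟩ := hν.exists_open_solid (h.isClosed D (by simp))
      (h.isSolidC D (by simp)) (hV.inter hV₁) (subset_inter hDV.1 hDV₁) hε
    have hOE : ∀ E ∈ 𝒟, Function.update O D W E = O E := fun E hE =>
      Function.update_of_ne (fun hED : E = D => hD (hED ▸ hE)) _ _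
    have hWO : ∀ E ∈ 𝒟, Disjoint W (O E) := fun E hE =>
      hVV.mono (hWV.trans inter_subset_right) ((hO E hE).2.2.1.trans inter_subset_right)
    refine ⟨Function.update O D W, ?_, ?_⟩
    · intro E hE
      rcases Finset.mem_insert.1 hE with rfl | hE
      · rw [Function.update_self]
        exact ⟨hW, hDW, hWV.trans inter_subset_left, hWε⟩
      · rw [hOE E hE]
        obtain ⟨h1, h2, h3, h4⟩ := hO E hE
        exact ⟨h1, h2, h3.trans inter_subset_left, h4⟩
    · intro E hE E' hE' hne
      simp only [Function.onFun]
      rcases Finset.mem_insert.1 (Finset.mem_coe.1 hE) with hED | hE₁ <;>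
        rcases Finset.mem_insert.1 (Finset.mem_coe.1 hE') with hED' | hE₂
      · exact absurd (hED.trans hED'.symm) hne
      · rw [hED, Function.update_self, hOE _ hE₂]
        exact hWO _ hE₂
      · rw [hED', Function.update_self, hOE _ hE₁]
        exact (hWO _ hE₁).symm
      · rw [hOE _ hE₁, hOE _ hE₂]
        exact hOd hE₁ hE₂ hne

variable [ConnectedSpace Y]

/-- The complement of finitely many disjoint closed solid sets contains, up to `ε`, the expected
mass: replace the closed solid sets by slightly larger open ones; what is left is a tame
continuum. -/
lemma IsSolidSetFunctionC.le_openValue_compl_closed_solid (hν : IsSolidSetFunctionC ν)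
    (hg : genus Y = 0) {𝒟 : Finset (Set Y)} (h : IsClosedSolidFamily 𝒟) :
    ν univ - ∑ D ∈ 𝒟, (ν D : ℝ) ≤ openValue ν (⋃₀ (𝒟 : Set (Set Y)))ᶜ := by
  classical
  refine le_of_forall_pos_le_add fun ε hε => ?_
  obtain ⟨O, hO, hOd⟩ := hν.exists_disjoint_open_solid h isOpen_univ (subset_univ _)
    (show 0 < ε / (𝒟.card + 1) by positivity)
  have hsum : ∑ D ∈ 𝒟, (ν (O D) : ℝ) ≤ ∑ D ∈ 𝒟, (ν D : ℝ) + ε := by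
    have h1 := Finset.sum_le_sum (fun D hD => (hO D hD).2.2.2)
    rw [Finset.sum_add_distrib, Finset.sum_const, nsmul_eq_mul] at h1
    have h2 : (𝒟.card : ℝ) * (ε / (𝒟.card + 1)) ≤ ε := by
      rw [← mul_div_assoc, div_le_iff₀ (by positivity)]
      nlinarith
    linarith
  have hne : ∀ D ∈ 𝒟, (O D).Nonempty := fun D hD => (h.nonempty D hD).mono (hO D hD).2.1
  have hinj : ∀ D ∈ 𝒟, ∀ E ∈ 𝒟, O D = O E → D = E := by
    intro D hD E hE hDE
    by_contra hne'
    have h1 := hOd hD hE hne'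
    simp only [Function.onFun] at h1
    rw [hDE, disjoint_self] at h1
    exact (hne E hE).ne_empty h1
  have hBs : ∀ B ∈ 𝒟.image O, IsOpen B ∧ IsSolidC B := by
    intro B hB
    obtain ⟨D, hD, rfl⟩ := Finset.mem_image.1 hB
    exact (hO D hD).1
  have hBn : ∀ B ∈ 𝒟.image O, B.Nonempty := by
    intro B hB
    obtain ⟨D, hD, rfl⟩ := Finset.mem_image.1 hB
    exact hne D hD
  have hBd : ((𝒟.image O : Finset (Set Y)) : Set (Set Y)).PairwiseDisjoint id := by
    intro B hB B' hB' hne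
    obtain ⟨D, hD, rfl⟩ := Finset.mem_image.1 (Finset.mem_coe.1 hB)
    obtain ⟨D', hD', rfl⟩ := Finset.mem_image.1 (Finset.mem_coe.1 hB')
    exact hOd hD hD' (fun hDD => hne (hDD ▸ rfl))
  rcases (⋃₀ ((𝒟.image O : Finset (Set Y)) : Set (Set Y)))ᶜ.eq_empty_or_nonempty with hem | hnem
  · -- the space is connected, so one of the open solid sets is the whole space
    obtain ⟨y⟩ : Nonempty Y := inferInstance
    have hy : y ∈ ⋃₀ ((𝒟.image O : Finset (Set Y)) : Set (Set Y)) := by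
      rw [compl_empty_iff.1 hem]
      trivial
    obtain ⟨B, hB, hyB⟩ := hy
    have hBuniv : B = univ := by
      refine IsClopen.eq_univ ⟨?_, (hBs B hB).1⟩ ⟨y, hyB⟩
      have : B = (⋃₀ (((𝒟.image O : Finset (Set Y)) : Set (Set Y)) \ {B}))ᶜ := by
        ext x
        constructor
        · rintro hx ⟨C, hC, hxC⟩
          exact (hBd hB hC.1 (fun h => hC.2 h.symm)).le_bot ⟨hx, hxC⟩
        · intro hx
          by_contra hxB
          have : x ∈ ⋃₀ ((𝒟.image O : Finset (Set Y)) : Set (Set Y)) := by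
            rw [compl_empty_iff.1 hem]
            trivial
          obtain ⟨C, hC, hxC⟩ := this
          exact hx ⟨C, ⟨hC, fun hCB => hxB (hCB ▸ hxC)⟩, hxC⟩
      rw [this]
      exact (isOpen_sUnion fun C hC => (hBs C hC.1).1).isClosed_compl
    obtain ⟨D, hD, hDB⟩ := Finset.mem_image.1 (Finset.mem_coe.1 hB)
    have h1 : (ν (O D) : ℝ) ≤ ∑ D ∈ 𝒟, (ν (O D) : ℝ) :=
      Finset.single_le_sum (f := fun D => (ν (O D) : ℝ)) (fun E _ => (ν (O E)).2) hD
    rw [hDB, hBuniv] at h1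
    have := hν.openValue_nonneg (⋃₀ (𝒟 : Set (Set Y)))ᶜ
    linarith
  · have htame := isTame_compl_sUnion hg _ hBs hBn hBd hnem
    have h1 := hν.le_openValue (U := (⋃₀ (𝒟 : Set (Set Y)))ᶜ)
      (𝒦 := {(⋃₀ ((𝒟.image O : Finset (Set Y)) : Set (Set Y)))ᶜ})
      ⟨by simpa using htame, by simp⟩ ?_
    · rw [Finset.sum_singleton, continuumValue_compl_sUnion hBs hBn hBd, Finset.sum_image] at h1
      · linarith
      · exact hinj
    · rw [Finset.coe_singleton, sUnion_singleton, compl_subset_compl]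
      rintro x ⟨D, hD, hx⟩
      exact ⟨O D, Finset.mem_coe.2 (Finset.mem_image_of_mem O hD), (hO D hD).2.1 hx⟩

/-- The complement of disjoint tame continua and closed solid sets carries at least the rest of
the total mass. -/
lemma IsSolidSetFunctionC.le_openValue_compl (hν : IsSolidSetFunctionC ν)
    (hg : genus Y = 0) {𝒦 𝒟 : Finset (Set Y)}
    (h𝒦 : IsTameFamily 𝒦) (h𝒟 : IsClosedSolidFamily 𝒟)
    (hd : ∀ K ∈ 𝒦, ∀ D ∈ 𝒟, Disjoint K D) :
    ν univ - ∑ D ∈ 𝒟, (ν D : ℝ) - ∑ K ∈ 𝒦, continuumValue ν K ≤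
      openValue ν (⋃₀ (𝒦 : Set (Set Y)) ∪ ⋃₀ (𝒟 : Set (Set Y)))ᶜ := by
  classical
  induction 𝒦 using Finset.strongInduction generalizing 𝒟 with
  | H 𝒦 ih =>
  rcases 𝒦.eq_empty_or_nonempty with rfl | ⟨K, hK𝒦⟩
  · simpa using hν.le_openValue_compl_closed_solid hg h𝒟
  have hK := h𝒦.isTame K hK𝒦
  have hdK : ∀ L ∈ 𝒦.erase K, Disjoint K L := fun L hL =>
    h𝒦.disjoint hK𝒦 (Finset.mem_of_mem_erase hL) (Finset.ne_of_mem_erase hL).symm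
  -- `O B` is the part of the complement that lies in the branch `B` of `K`
  let O : Set Y → Set Y := fun B =>
    (⋃₀ (({L ∈ 𝒦.erase K | L ⊆ B} : Finset (Set Y)) : Set (Set Y)) ∪
      ⋃₀ (branchFamily 𝒟 B : Set (Set Y)))ᶜ
  have hstep : ∀ B ∈ hK.branches, (ν B : ℝ) - ∑ D ∈ 𝒟 with D ⊆ B, (ν D : ℝ) -
      ∑ L ∈ 𝒦.erase K with L ⊆ B, continuumValue ν L ≤ openValue ν (O B) := by
    intro B hB
    have hsub : ({L ∈ 𝒦.erase K | L ⊆ B} : Finset (Set Y)) ⊂ 𝒦 :=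
      (Finset.filter_subset _ _).trans_ssubset (Finset.erase_ssubset hK𝒦)
    have h1 := ih _ hsub (h𝒦.subset hsub.subset) (hK.isClosedSolidFamily_branchFamily hB h𝒟)
      (fun L hL => disjoint_branchFamily (Finset.mem_filter.1 hL).2 (hd L (hsub.subset hL)))
    rw [sum_branchFamily h𝒟.nonempty] at h1
    have h2 := hν.add_compl (Or.inl (hK.isOpen_branch hB)) (hK.isSolidC_branch hB)
    refine le_trans ?_ h1
    linarith
  have hOB : ∀ B, O B ⊆ B := by
    intro B x hx
    by_contra hxB
    exact hx (Or.inr ⟨Bᶜ, by simp [branchFamily], hxB⟩)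
  have hbranch : ∀ B ∈ hK.branches, ∀ S, IsPreconnected S → Disjoint K S →
      (S ∩ B).Nonempty → S ⊆ B := by
    intro B hB S hS hKS hne
    obtain ⟨C, hC, hSC⟩ := exists_subset_mem_components hS (hne.mono inter_subset_left)
      hKS.subset_compl_left
    rwa [eq_of_mem_components (hK.mem_branches.1 hB) hC
      (hne.mono fun x hx => ⟨hx.2, hSC hx.1⟩)]
  have hunion : (⋃ B ∈ hK.branches, O B) ⊆
      (⋃₀ (𝒦 : Set (Set Y)) ∪ ⋃₀ (𝒟 : Set (Set Y)))ᶜ := by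
    refine iUnion₂_subset fun B hB x hx => ?_
    have hxB := hOB B hx
    rintro (⟨L, hL, hxL⟩ | ⟨D, hD, hxD⟩)
    · by_cases hLK : L = K
      · exact (hK.branch_disjoint hB).le_bot ⟨hLK ▸ hxL, hxB⟩
      · have hL' := Finset.mem_erase.2 ⟨hLK, Finset.mem_coe.1 hL⟩
        have := hbranch B hB L (h𝒦.isTame L hL).isPreconnected (hdK L hL') ⟨x, hxL, hxB⟩
        exact hx (Or.inl ⟨L, Finset.mem_coe.2 (Finset.mem_filter.2 ⟨hL', this⟩), hxL⟩)
    · have := hbranch B hB D (h𝒟.isSolidC D hD).1 (hd K hK𝒦 D hD) ⟨x, hxD, hxB⟩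
      exact hx (Or.inr ⟨D, by simp [branchFamily, this, Finset.mem_coe.1 hD], hxD⟩)
  have hOd : (hK.branches : Set (Set Y)).PairwiseDisjoint O := by
    intro B hB B' hB' hne
    exact (pairwiseDisjoint_components Kᶜ (hK.mem_branches.1 hB) (hK.mem_branches.1 hB')
      hne).mono (hOB B) (hOB B')
  have h1 := (Finset.sum_le_sum hstep).trans
    ((hν.sum_openValue_le hK.branches O hOd).trans (hν.openValue_mono hunion))
  rw [Finset.sum_sub_distrib, Finset.sum_sub_distrib, hK.sum_branches, hK.sum_branches] at h1
  · have h2 := hK.continuumValue_eq (ν := ν)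
    rw [← Finset.add_sum_erase _ _ hK𝒦]
    linarith
  · exact fun L hL => (h𝒦.isTame L (Finset.mem_of_mem_erase hL)).nonempty
  · exact fun L hL => (h𝒦.isTame L (Finset.mem_of_mem_erase hL)).isPreconnected
  · exact hdK
  · exact h𝒟.nonempty
  · exact fun D hD => (h𝒟.isSolidC D hD).1
  · exact hd K hK𝒦

lemma IsSolidSetFunctionC.openValue_compl_tameFamily (hν : IsSolidSetFunctionC ν)
    (hg : genus Y = 0) {𝒦 : Finset (Set Y)} (h𝒦 : IsTameFamily 𝒦) :
    openValue ν (⋃₀ (𝒦 : Set (Set Y)))ᶜ = ν univ - ∑ K ∈ 𝒦, continuumValue ν K := by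
  classical
  refine le_antisymm (openValue_le fun ℒ hℒ hU => ?_) ?_
  · have hdis : ∀ L ∈ ℒ, ∀ K ∈ 𝒦, Disjoint L K := fun L hL K hK =>
      disjoint_left.2 fun x hxL hxK => hU ⟨L, hL, hxL⟩ ⟨K, hK, hxK⟩
    have hfam : IsTameFamily (ℒ ∪ 𝒦) := by
      refine ⟨fun K hK => (Finset.mem_union.1 hK).elim (hℒ.isTame K) (h𝒦.isTame K), ?_⟩
      intro K hK L hL hne
      rcases Finset.mem_union.1 (Finset.mem_coe.1 hK) with hK | hK <;>
        rcases Finset.mem_union.1 (Finset.mem_coe.1 hL) with hL | hL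
      · exact hℒ.disjoint hK hL hne
      · exact hdis K hK L hL
      · exact (hdis L hL K hK).symm
      · exact h𝒦.disjoint hK hL hne
    have h1 := hν.sum_continuumValue_add_le hfam isClosedSolidFamily_empty (by simp)
    rw [Finset.sum_union] at h1
    · simp only [Finset.sum_empty, add_zero] at h1
      linarith
    · refine Finset.disjoint_left.2 fun K hK hK' => ?_
      exact (hℒ.isTame K hK).nonempty.ne_empty (disjoint_self.1 (hdis K hK K hK'))
  · simpa using hν.le_openValue_compl hg h𝒦 isClosedSolidFamily_empty (by simp)

lemma IsSolidSetFunctionC.openValue_univ (hν : IsSolidSetFunctionC ν) (hg : genus Y = 0) :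
    openValue ν univ = ν univ := by
  simpa using hν.openValue_compl_tameFamily hg isTameFamily_empty

/-- The value on open sets extends the given solid set function. -/
lemma IsSolidSetFunctionC.openValue_open_solid (hν : IsSolidSetFunctionC ν) (hg : genus Y = 0)
    {U : Set Y} (hU : IsOpen U) (hs : IsSolidC U) : openValue ν U = ν U := by
  rcases eq_or_ne U univ with rfl | hne
  · exact hν.openValue_univ hg
  have hfam := isClosedSolidFamily_singleton (nonempty_compl.2 hne) hU.isClosed_compl hs.compl
  have hadd := hν.add_compl (Or.inl hU) hs
  refine le_antisymm (openValue_le fun 𝒦 h𝒦 hKU => ?_) ?_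
  · have := hν.sum_continuumValue_add_le h𝒦 hfam (fun K hK D hD => by
      rw [Finset.mem_singleton.1 hD]
      exact disjoint_compl_right.mono_left ((subset_sUnion_of_mem (Finset.mem_coe.2 hK)).trans hKU))
    rw [Finset.sum_singleton] at this
    linarith
  · have := hν.le_openValue_compl_closed_solid hg hfam
    rw [Finset.sum_singleton, Finset.coe_singleton, sUnion_singleton, compl_compl] at this
    linarith

/-- Two open sets that cover the space have at least the total mass. -/
lemma IsSolidSetFunctionC.le_openValue_add (hν : IsSolidSetFunctionC ν) (hg : genus Y = 0)
    {U V : Set Y} (hU : IsOpen U) (hV : IsOpen V) (h : Vᶜ ⊆ U) :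
    ν univ ≤ openValue ν U + openValue ν V := by
  obtain ⟨𝒦, h𝒦, hVK, hKU⟩ := exists_tameFamily_between hg hV.isClosed_compl hU h
  have h1 := hν.openValue_compl_tameFamily hg h𝒦
  have h2 := hν.openValue_mono (compl_subset_comm.1 hVK)
  have h3 := hν.le_openValue h𝒦 hKU
  linarith

lemma IsSolidSetFunctionC.extension_closed (hν : IsSolidSetFunctionC ν) (hg : genus Y = 0)
    {K : Set Y} (hK : IsClosed K) : extension ν K = ν univ - openValue ν Kᶜ := by
  refine le_antisymm (le_of_forall_pos_le_add fun ε hε => ?_) (le_extension fun U hU hKU => ?_)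
  · obtain ⟨𝒦, h𝒦, hsub, hlt⟩ := exists_lt_of_lt_openValue (sub_lt_self (openValue ν Kᶜ) hε)
    have h1 := hν.extension_le h𝒦.isClosed_sUnion.isOpen_compl (subset_compl_comm.1 hsub)
    rw [hν.openValue_compl_tameFamily hg h𝒦] at h1
    linarith
  · have := hν.le_openValue_add hg hU hK.isOpen_compl (by rwa [compl_compl])
    linarith

lemma IsSolidSetFunctionC.extension_tameFamily (hν : IsSolidSetFunctionC ν) (hg : genus Y = 0)
    {𝒦 : Finset (Set Y)} (h𝒦 : IsTameFamily 𝒦) :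
    extension ν (⋃₀ (𝒦 : Set (Set Y))) = ∑ K ∈ 𝒦, continuumValue ν K := by
  rw [hν.extension_closed hg h𝒦.isClosed_sUnion, hν.openValue_compl_tameFamily hg h𝒦]
  ring

lemma IsSolidSetFunctionC.extension_add_compl (hν : IsSolidSetFunctionC ν) (hg : genus Y = 0)
    {A : Set Y} (hA : IsOpen A ∨ IsClosed A) :
    extension ν A + extension ν Aᶜ = ν univ := by
  rcases hA with hA | hA
  · rw [hν.extension_open hA, hν.extension_closed hg hA.isClosed_compl, compl_compl]
    ring
  · rw [hν.extension_open hA.isOpen_compl, hν.extension_closed hg hA]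
    ring

/-- The topological measure extends the given solid set function. -/
lemma IsSolidSetFunctionC.extension_solid (hν : IsSolidSetFunctionC ν) (hg : genus Y = 0)
    {A : Set Y} (hA : IsOpen A ∨ IsClosed A) (hs : IsSolidC A) : extension ν A = ν A := by
  rcases hA with hA | hA
  · rw [hν.extension_open hA, hν.openValue_open_solid hg hA hs]
  · rw [hν.extension_closed hg hA, hν.openValue_open_solid hg hA.isOpen_compl hs.compl]
    linarith [hν.add_compl (Or.inr hA) hs]

lemma IsSolidSetFunctionC.extension_union_closed (hν : IsSolidSetFunctionC ν)
    {A B : Set Y} (hA : IsClosed A) (hB : IsClosed B) (hAB : Disjoint A B) :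
    extension ν (A ∪ B) = extension ν A + extension ν B := by
  obtain ⟨V, W, hV, hW, hAV, hBW, hVW⟩ := normal_separation hA hB hAB
  refine le_antisymm (le_of_forall_pos_le_add fun ε hε => ?_) (le_extension fun U hU hABU => ?_)
  · obtain ⟨U₁, hU₁, hAU, h1⟩ := exists_openValue_lt (lt_add_of_pos_right (extension ν A)
      (half_pos hε))
    obtain ⟨U₂, hU₂, hBU, h2⟩ := exists_openValue_lt (lt_add_of_pos_right (extension ν B)
      (half_pos hε))
    have h3 := hν.extension_le ((hU₁.inter hV).union (hU₂.inter hW))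
      (union_subset_union (subset_inter hAU hAV) (subset_inter hBU hBW))
    rw [hν.openValue_union (hU₁.inter hV) (hU₂.inter hW)
      (hVW.mono inter_subset_right inter_subset_right)] at h3
    have h4 := hν.openValue_mono (inter_subset_left : U₁ ∩ V ⊆ U₁)
    have h5 := hν.openValue_mono (inter_subset_left : U₂ ∩ W ⊆ U₂)
    linarith
  · obtain ⟨hAU, hBU⟩ := union_subset_iff.1 hABU
    have h1 := hν.extension_le (hU.inter hV) (subset_inter hAU hAV)
    have h2 := hν.extension_le (hU.inter hW) (subset_inter hBU hBW)
    have h3 := hν.openValue_add_le (hVW.mono inter_subset_right inter_subset_right :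
      Disjoint (U ∩ V) (U ∩ W))
    have h4 := hν.openValue_mono (union_subset inter_subset_left inter_subset_left :
      U ∩ V ∪ U ∩ W ⊆ U)
    linarith

/-- Additivity in the mixed case reduces, by passing to the complements, to the case of two open
or two closed sets. -/
lemma IsSolidSetFunctionC.extension_union_open_closed (hν : IsSolidSetFunctionC ν)
    (hg : genus Y = 0) {A B : Set Y} (hA : IsOpen A) (hB : IsClosed B)
    (hU : IsOpen (A ∪ B) ∨ IsClosed (A ∪ B)) (hAB : Disjoint A B) :
    extension ν (A ∪ B) = extension ν A + extension ν B := by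
  have hc := hν.extension_add_compl hg hU
  rcases hU with hU | hU
  · have h1 : Aᶜ = B ∪ (A ∪ B)ᶜ := by
      ext x
      have : x ∈ A → x ∉ B := fun h => disjoint_left.1 hAB h
      simp only [mem_compl_iff, mem_union]
      tauto
    have h2 := hν.extension_add_compl hg (Or.inl hA)
    rw [h1, hν.extension_union_closed hB hU.isClosed_compl
      (disjoint_compl_right.mono_left subset_union_right)] at h2
    linarith
  · have h1 : Bᶜ = A ∪ (A ∪ B)ᶜ := by
      ext x
      have : x ∈ A → x ∉ B := fun h => disjoint_left.1 hAB h
      simp only [mem_compl_iff, mem_union]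
      tauto
    have h2 := hν.extension_add_compl hg (Or.inr hB)
    rw [h1, hν.extension_union_open hA hU.isOpen_compl
      (disjoint_compl_right.mono_left subset_union_left)] at h2
    linarith

lemma IsSolidSetFunctionC.extension_union (hν : IsSolidSetFunctionC ν) (hg : genus Y = 0)
    {A B : Set Y} (hA : IsOpen A ∨ IsClosed A) (hB : IsOpen B ∨ IsClosed B)
    (hU : IsOpen (A ∪ B) ∨ IsClosed (A ∪ B)) (hAB : Disjoint A B) :
    extension ν (A ∪ B) = extension ν A + extension ν B := by
  rcases hA with hA | hA <;> rcases hB with hB | hB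
  · exact hν.extension_union_open hA hB hAB
  · exact hν.extension_union_open_closed hg hA hB hU hAB
  · rw [union_comm] at hU ⊢
    rw [hν.extension_union_open_closed hg hB hA hU hAB.symm, add_comm]
  · exact hν.extension_union_closed hA hB hAB

end Extension

/-! ### Finite solid partitions -/

section Partition

variable {Y : Type*} [TopologicalSpace Y]

lemma subsingleton_of_isPreconnected_sUnion_open {𝒮 : Set (Set Y)}
    (hpre : IsPreconnected (⋃₀ 𝒮)) (ho : ∀ S ∈ 𝒮, IsOpen S) (hn : ∀ S ∈ 𝒮, S.Nonempty)
    (hd : 𝒮.PairwiseDisjoint id) : 𝒮.Subsingleton := by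
  intro S hS T hT
  by_contra hne
  have hdis : Disjoint S (⋃₀ (𝒮 \ {S})) := by
    rw [disjoint_sUnion_right]
    exact fun R hR => hd hS hR.1 (fun h => hR.2 h.symm)
  obtain ⟨x, hx⟩ := hn S hS
  have := hpre.subset_left_of_subset_union (ho S hS) (isOpen_sUnion fun R hR => ho R hR.1) hdis
    (by
      rintro y ⟨R, hR, hy⟩
      by_cases h : R = S
      · exact Or.inl (h ▸ hy)
      · exact Or.inr ⟨R, ⟨hR, h⟩, hy⟩) ⟨x, mem_sUnion.2 ⟨S, hS, hx⟩, hx⟩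
  obtain ⟨y, hy⟩ := hn T hT
  exact (hd hS hT hne).le_bot ⟨this ⟨T, hT, hy⟩, hy⟩

lemma subsingleton_of_isPreconnected_sUnion_closed {𝒮 : Finset (Set Y)}
    (hpre : IsPreconnected (⋃₀ (𝒮 : Set (Set Y)))) (hc : ∀ S ∈ 𝒮, IsClosed S)
    (hn : ∀ S ∈ 𝒮, S.Nonempty) (hd : (𝒮 : Set (Set Y)).PairwiseDisjoint id) :
    (𝒮 : Set (Set Y)).Subsingleton := by
  classical
  intro S hS T hT
  by_contra hne
  have hdis : Disjoint S (⋃₀ ((𝒮.erase S : Finset (Set Y)) : Set (Set Y))) := by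
    rw [disjoint_sUnion_right]
    intro R hR
    have := Finset.mem_erase.1 (Finset.mem_coe.1 hR)
    exact hd hS this.2 this.1.symm
  have h := isPreconnected_iff_subset_of_disjoint_closed.1 hpre S
    (⋃₀ ((𝒮.erase S : Finset (Set Y)) : Set (Set Y))) (hc S hS)
    (isClosed_sUnion_finset fun R hR => hc R (Finset.mem_of_mem_erase hR))
    (by
      rintro y ⟨R, hR, hy⟩
      by_cases h : R = S
      · exact Or.inl (h ▸ hy)
      · exact Or.inr ⟨R, Finset.mem_coe.2 (Finset.mem_erase.2 ⟨h, hR⟩), hy⟩)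
    (by rw [hdis.inter_eq, inter_empty])
  obtain ⟨x, hx⟩ := hn S hS
  obtain ⟨y, hy⟩ := hn T hT
  rcases h with h | h
  · exact (hd hS hT hne).le_bot ⟨h ⟨T, hT, hy⟩, hy⟩
  · exact hdis.le_bot ⟨hx, h ⟨S, hS, hx⟩⟩

/-- In genus zero a finite partition into solid sets has at most one closed and at most one open
member, since the union of the closed members and that of the open members are both connected. -/
lemma card_partition_le_two [CompactSpace Y] [T2Space Y] [LocallyConnectedSpace Y]
    [ConnectedSpace Y] (hg : genus Y = 0) {P : Finset (Set Y)} (hn : ∀ A ∈ P, A.Nonempty)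
    (hs : ∀ A ∈ P, IsSolidC A) (ho : ∀ A ∈ P, IsOpen A ∨ IsClosed A)
    (hd : (P : Set (Set Y)).PairwiseDisjoint id) (hcov : ⋃₀ (P : Set (Set Y)) = univ) :
    P.card ≤ 2 := by
  classical
  set 𝒞 := P.filter IsClosed with h𝒞
  set 𝒪 := P.filter (fun A => ¬ IsClosed A) with h𝒪
  have hC : ∀ A ∈ 𝒞, A ∈ P ∧ IsClosed A := fun A hA => Finset.mem_filter.1 hA
  have hO : ∀ A ∈ 𝒪, A ∈ P ∧ IsOpen A := fun A hA =>
    ⟨(Finset.mem_filter.1 hA).1, (ho A (Finset.mem_filter.1 hA).1).resolve_right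
      (Finset.mem_filter.1 hA).2⟩
  have hCd : (𝒞 : Set (Set Y)).PairwiseDisjoint id := hd.subset fun A hA => (hC A hA).1
  have hOd : (𝒪 : Set (Set Y)).PairwiseDisjoint id := hd.subset fun A hA => (hO A hA).1
  have hcompl : (⋃₀ (𝒞 : Set (Set Y)))ᶜ = ⋃₀ (𝒪 : Set (Set Y)) := by
    ext x
    constructor
    · intro hx
      obtain ⟨A, hA, hxA⟩ := (hcov ▸ mem_univ x : x ∈ ⋃₀ (P : Set (Set Y)))
      exact ⟨A, Finset.mem_coe.2 (Finset.mem_filter.2 ⟨hA, fun hAc =>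
        hx ⟨A, Finset.mem_coe.2 (Finset.mem_filter.2 ⟨hA, hAc⟩), hxA⟩⟩), hxA⟩
    · rintro ⟨A, hA, hxA⟩ ⟨B, hB, hxB⟩
      have hAB : A = B := by
        by_contra hne
        exact (hd (hO A hA).1 (hC B hB).1 hne).le_bot ⟨hxA, hxB⟩
      exact (Finset.mem_filter.1 (Finset.mem_coe.1 hA)).2 (hAB ▸ (hC B hB).2)
  have h1 : 𝒪.card ≤ 1 := by
    refine Finset.card_le_one.2 fun A hA B hB => (subsingleton_of_isPreconnected_sUnion_open ?_
      (fun A hA => (hO A hA).2) (fun A hA => hn A (hO A hA).1) hOd) hA hB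
    rw [← hcompl]
    exact isPreconnected_compl_sUnion_closed_solid hg 𝒞 (fun A hA => hn A (hC A hA).1)
      (fun A hA => ⟨(hC A hA).2, hs A (hC A hA).1⟩) hCd
  have h2 : 𝒞.card ≤ 1 := by
    refine Finset.card_le_one.2 fun A hA B hB => (subsingleton_of_isPreconnected_sUnion_closed ?_
      (fun A hA => (hC A hA).2) (fun A hA => hn A (hC A hA).1) hCd) hA hB
    rw [← compl_compl (⋃₀ (𝒞 : Set (Set Y))), hcompl]
    exact isPreconnected_compl_sUnion_open_solid hg 𝒪
      (fun A hA => ⟨(hO A hA).2, hs A (hO A hA).1⟩) hOd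
  have h3 : 𝒞.card + 𝒪.card = P.card := Finset.card_filter_add_card_filter_not _
  omega

end Partition

/-! ### Solid sets in the one-point compactification -/

section OnePoint

open OnePoint

variable {X : Type*} [TopologicalSpace X]

lemma infty_mem_closure_image {V : Set X} (h : ¬ IsBdd V) :
    infty ∈ closure ((fun x : X => (x : OnePoint X)) '' V) := by
  by_contra hcon
  have h1 := ((isClosed_iff_of_notMem hcon).1 isClosed_closure)
  refine h (h1.2.of_isClosed_subset isClosed_closure (closure_minimal ?_ h1.1))
  exact fun x hx => subset_closure ⟨x, hx, rfl⟩

lemma isPreconnected_insert_infty {V : Set X} (hV : IsPreconnected V) (h : ¬ IsBdd V) :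
    IsPreconnected (insert infty ((fun x : X => (x : OnePoint X)) '' V)) :=
  (hV.image _ continuous_coe.continuousOn).subset_closure (subset_insert _ _)
    (insert_subset (infty_mem_closure_image h) subset_closure)

/-- The one-point compactification of a connected, locally connected space is locally connected
at infinity: only finitely many components of the complement of a compact set fail to lie in a
given compact neighbourhood of that set, so that the unbounded components, together with infinity,
form a neighbourhood of infinity. -/
lemma locallyConnectedSpace_onePoint [T2Space X] [LocallyCompactSpace X] [ConnectedSpace X]
    [LocallyConnectedSpace X] : LocallyConnectedSpace (OnePoint X) := by
  rw [locallyConnectedSpace_iff_connected_subsets]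
  intro y U hU
  induction y using OnePoint.rec with
  | coe x =>
    rw [nhds_coe_eq, Filter.mem_map] at hU
    obtain ⟨V, hV, hVc, hVU⟩ := locallyConnectedSpace_iff_connected_subsets.1 inferInstance x _ hU
    refine ⟨_, ?_, hVc.image _ continuous_coe.continuousOn, image_subset_iff.2 hVU⟩
    rw [nhds_coe_eq]
    exact Filter.image_mem_map hV
  | infty =>
    obtain ⟨K₀, ⟨-, hK₀⟩, hKU⟩ := hasBasis_nhds_infty.mem_iff.1 hU
    obtain ⟨p⟩ : Nonempty X := inferInstance
    set K := insert p K₀ with hKdef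
    have hK : IsCompact K := hK₀.insert p
    obtain ⟨L, hL, hKL⟩ := exists_compact_superset hK
    have hfr : frontier L ⊆ ⋃₀ components Kᶜ := by
      rw [sUnion_components]
      exact fun x hx hxK => hx.2 (hKL hxK)
    obtain ⟨T, hT, hTcov⟩ := exists_finset_subcover_sUnion
      (hL.of_isClosed_subset isClosed_frontier hL.isClosed.frontier_subset)
      (fun V hV => isOpen_of_mem_components hK.isClosed.isOpen_compl hV) hfr
    set E : Set X := L ∪ ⋃ V ∈ {V ∈ (T : Set (Set X)) | IsBdd V}, closure V with hE
    have hEc : IsCompact E := by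
      refine hL.union ((T.finite_toSet.subset (sep_subset _ _)).isCompact_biUnion ?_)
      exact fun V hV => hV.2
    set 𝒱 : Set (Set X) := {V ∈ components Kᶜ | ¬ IsBdd V} with h𝒱
    refine ⟨⋃₀ (insert {infty} ((fun V => insert infty ((fun x : X => (x : OnePoint X)) '' V)) '' 𝒱)),
      ?_, ?_, ?_⟩
    · refine hasBasis_nhds_infty.mem_iff.2 ⟨E, ⟨hEc.isClosed, hEc⟩, ?_⟩
      rintro _ (⟨x, hx, rfl⟩ | rfl)
      · have hxL : x ∉ L := fun h => hx (Or.inl h)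
        have hxK : x ∈ Kᶜ := fun h => hxL (interior_subset (hKL h))
        have hV : connectedComponentIn Kᶜ x ∈ components Kᶜ := ⟨x, hxK, rfl⟩
        have hxV := mem_connectedComponentIn hxK
        refine ⟨_, Or.inr ⟨_, ⟨hV, fun hb => ?_⟩, rfl⟩, Or.inr ⟨x, hxV, rfl⟩⟩
        -- a bounded component that leaves `L` crosses the frontier of `L`
        obtain ⟨z, hz, hzK⟩ := closure_component_inter_compl hK.isClosed.isOpen_compl
          (fun h => (h ▸ mem_univ p : p ∈ Kᶜ) (mem_insert _ _)) hV
        rw [compl_compl] at hzK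
        obtain ⟨w, hwL, hwV⟩ := mem_closure_iff.1 hz _ isOpen_interior (hKL hzK)
        have hcross : (connectedComponentIn Kᶜ x ∩ frontier L).Nonempty := by
          by_contra hcon
          rw [not_nonempty_iff_eq_empty] at hcon
          have := (isPreconnected_of_mem_components hV).subset_left_of_subset_union
            isOpen_interior hL.isClosed.isOpen_compl
            (disjoint_compl_right.mono_left interior_subset) (fun y hy => by
              by_cases hyL : y ∈ L
              · left
                by_contra hyi
                exact hcon.subset ⟨hy, subset_closure hyL, hyi⟩
              · exact Or.inr hyL) ⟨w, hwV, hwL⟩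
          exact hxL (interior_subset (this hxV))
        obtain ⟨q, hqV, hqL⟩ := hcross
        obtain ⟨W, hW, hqW⟩ := hTcov hqL
        have hWV := eq_of_mem_components (hT hW) hV ⟨q, hqW, hqV⟩
        exact hx (Or.inr (mem_biUnion (show connectedComponentIn Kᶜ x ∈ _ from
          ⟨hWV ▸ hW, hb⟩) (subset_closure hxV)))
      · exact ⟨{infty}, mem_insert _ _, rfl⟩
    · refine isPreconnected_sUnion infty _ ?_ ?_
      · rintro _ (rfl | ⟨V, -, rfl⟩)
        · rfl
        · exact mem_insert _ _
      · rintro _ (rfl | ⟨V, hV, rfl⟩)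
        · exact isPreconnected_singleton
        · exact isPreconnected_insert_infty (isPreconnected_of_mem_components hV.1) hV.2
    · refine Subset.trans ?_ hKU
      rintro _ ⟨_, (rfl | ⟨V, hV, rfl⟩), hx⟩
      · exact Or.inr hx
      · rcases hx with rfl | ⟨x, hx, rfl⟩
        · exact Or.inr rfl
        · exact Or.inl ⟨x, fun hxK => subset_of_mem_components hV.1 hx (mem_insert_of_mem _ hxK),
            rfl⟩

lemma isOpen_or_isClosed_image [T2Space X] {A : Set X} (h : IsCompact A ∨ IsOpen A) :
    IsOpen ((fun x : X => (x : OnePoint X)) '' A) ∨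
      IsClosed ((fun x : X => (x : OnePoint X)) '' A) := by
  rcases h with h | h
  · exact Or.inr (isClosed_image_coe.2 ⟨h.isClosed, h⟩)
  · exact Or.inl (isOpen_image_coe.2 h)

lemma IsSolid.isSolidC_image {A : Set X} (h : IsSolid A) :
    IsSolidC ((fun x : X => (x : OnePoint X)) '' A) := by
  refine ⟨h.1.image _ continuous_coe.continuousOn, ?_⟩
  have : ((fun x : X => (x : OnePoint X)) '' A)ᶜ = ⋃₀ (insert {infty}
      ((fun V => insert infty ((fun x : X => (x : OnePoint X)) '' V)) '' components Aᶜ)) := by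
    rw [compl_image_coe]
    ext y
    constructor
    · rintro (⟨x, hx, rfl⟩ | hy)
      · exact ⟨_, Or.inr ⟨_, ⟨x, hx, rfl⟩, rfl⟩, Or.inr ⟨x, mem_connectedComponentIn hx, rfl⟩⟩
      · exact ⟨{infty}, mem_insert _ _, hy⟩
    · rintro ⟨_, (rfl | ⟨V, hV, rfl⟩), hy⟩
      · exact Or.inr hy
      · rcases hy with rfl | ⟨x, hx, rfl⟩
        · exact Or.inr rfl
        · exact Or.inl ⟨x, subset_of_mem_components hV hx, rfl⟩
  rw [this]
  refine isPreconnected_sUnion infty _ ?_ ?_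
  · rintro _ (rfl | ⟨V, -, rfl⟩)
    · rfl
    · exact mem_insert _ _
  · rintro _ (rfl | ⟨V, ⟨x, hx, rfl⟩, rfl⟩)
    · exact isPreconnected_singleton
    · exact isPreconnected_insert_infty isPreconnected_connectedComponentIn (h.2 x hx)

lemma isPreconnected_of_image {A : Set X}
    (h : IsPreconnected ((fun x : X => (x : OnePoint X)) '' A)) : IsPreconnected A :=
  isOpenEmbedding_coe.isInducing.isPreconnected_image.1 h

/-- A relatively open subset of `Aᶜ` that is cut out by a compact set is also relatively clopen in
the complement of `A` in the compactification, where it misses infinity. So it is empty if that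
complement is connected. -/
lemma eq_empty_of_relatively_clopen {A E O : Set X}
    (h : IsPreconnected ((fun x : X => (x : OnePoint X)) '' A)ᶜ) (hO : IsOpen O)
    {F : Set X} (hF : IsClosed F) (hFc : IsCompact F) (hEO : E = O ∩ Aᶜ) (hEF : E = F ∩ Aᶜ) :
    E = ∅ := by
  by_contra hne
  obtain ⟨x, hx⟩ := nonempty_iff_ne_empty.2 hne
  have hv : IsOpen ((fun x : X => (x : OnePoint X)) '' F)ᶜ :=
    (isClosed_image_coe.2 ⟨hF, hFc⟩).isOpen_compl
  have hxA : x ∈ Aᶜ := (hEO.subset hx).2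
  have hcov : ((fun x : X => (x : OnePoint X)) '' A)ᶜ ⊆
      (fun x : X => (x : OnePoint X)) '' O ∪ ((fun x : X => (x : OnePoint X)) '' F)ᶜ := by
    intro y hy
    by_cases hyF : y ∈ (fun x : X => (x : OnePoint X)) '' F
    · obtain ⟨z, hzF, rfl⟩ := hyF
      have hzA : z ∈ Aᶜ := fun hz => hy ⟨z, hz, rfl⟩
      exact Or.inl ⟨z, (hEO.subset (hEF.superset ⟨hzF, hzA⟩)).1, rfl⟩
    · exact Or.inr hyF
  have hxA' : (x : OnePoint X) ∉ (fun x : X => (x : OnePoint X)) '' A := by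
    rintro ⟨z, hz, hzx⟩
    exact hxA (coe_injective hzx ▸ hz)
  obtain ⟨y, hy, ⟨z, hzO, rfl⟩, hyF⟩ := h _ _ (isOpen_image_coe.2 hO) hv hcov
    ⟨x, hxA', x, (hEO.subset hx).1, rfl⟩ ⟨infty, infty_notMem_image_coe, infty_notMem_image_coe⟩
  have hzA : z ∈ Aᶜ := fun hz => hy ⟨z, hz, rfl⟩
  exact hyF ⟨z, (hEF.subset (hEO.superset ⟨hzO, hzA⟩)).1, rfl⟩

lemma isSolid_of_isSolidC_image_of_isClosed [LocallyConnectedSpace X] {K : Set X}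
    (hK : IsClosed K) (h : IsSolidC ((fun x : X => (x : OnePoint X)) '' K)) : IsSolid K := by
  refine ⟨isPreconnected_of_image h.1, fun x hx hb => ?_⟩
  have hV : connectedComponentIn Kᶜ x ∈ components Kᶜ := ⟨x, hx, rfl⟩
  have := eq_empty_of_relatively_clopen h.2 (isOpen_of_mem_components hK.isOpen_compl hV)
    isClosed_closure hb (inter_eq_left.2 (subset_of_mem_components hV)).symm ?_
  · exact (nonempty_of_mem_components hV).ne_empty this
  · refine subset_antisymm (subset_inter subset_closure (subset_of_mem_components hV)) ?_
    rintro y ⟨hy, hyK⟩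
    exact (closure_component_subset hK.isOpen_compl hV hy).resolve_right (fun h => h hyK)

/-- Boundary bumping: a bounded component of the complement of an open set is compact, hence
lies in small sets that are clopen relative to this complement. -/
lemma isSolid_of_isSolidC_image_of_isOpen [T2Space X] [LocallyCompactSpace X] {A : Set X}
    (hA : IsOpen A) (h : IsSolidC ((fun x : X => (x : OnePoint X)) '' A)) : IsSolid A := by
  refine ⟨isPreconnected_of_image h.1, fun x hx hb => ?_⟩
  set C := connectedComponentIn Aᶜ x with hC
  have hxC : x ∈ C := mem_connectedComponentIn hx
  have hCA : closure C ⊆ Aᶜ :=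
    closure_minimal (connectedComponentIn_subset _ _) hA.isClosed_compl
  have hCcl : closure C = C := subset_antisymm
    (isPreconnected_connectedComponentIn.closure.subset_connectedComponentIn
      (subset_closure hxC) hCA) subset_closure
  have hCc : IsCompact C := hCcl ▸ hb
  obtain ⟨N, hN, hCN⟩ := exists_compact_superset hCc
  set T : Set X := Aᶜ ∩ N with hT
  have hTc : IsCompact T := hN.inter_left hA.isClosed_compl
  have hxT : x ∈ T := ⟨hx, interior_subset (hCN hxC)⟩
  have : CompactSpace T := isCompact_iff_compactSpace.1 hTc
  have hcomp : (fun t : T => (t : X)) '' connectedComponent (⟨x, hxT⟩ : T) ⊆ C := by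
    rw [← connectedComponentIn_eq_image hxT]
    exact connectedComponentIn_mono x inter_subset_left
  -- the component is an intersection of clopen sets, one of which avoids the frontier of `N`
  obtain ⟨Z, hZ, hxZ, hZN⟩ : ∃ Z : Set T, IsClopen Z ∧ (⟨x, hxT⟩ : T) ∈ Z ∧
      Z ⊆ (fun t : T => (t : X)) ⁻¹' interior N := by
    have h1 : (⋂ s : { s : Set T // IsClopen s ∧ (⟨x, hxT⟩ : T) ∈ s }, (s : Set T)) ⊆
        (fun t : T => (t : X)) ⁻¹' interior N := by
      rw [← connectedComponent_eq_iInter_isClopen]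
      exact fun t ht => hCN (hcomp ⟨t, ht, rfl⟩)
    have : Nonempty { s : Set T // IsClopen s ∧ (⟨x, hxT⟩ : T) ∈ s } :=
      ⟨⟨univ, isClopen_univ, mem_univ _⟩⟩
    obtain ⟨⟨Z, hZ, hxZ⟩, hZN⟩ := exists_subset_nhds_of_compactSpace
      (V := fun s : { s : Set T // IsClopen s ∧ (⟨x, hxT⟩ : T) ∈ s } => (s : Set T))
      (fun s t => ⟨⟨s ∩ t, s.2.1.inter t.2.1, s.2.2, t.2.2⟩, inter_subset_left,
        inter_subset_right⟩) (fun s => s.2.1.1)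
      (fun t ht => (isOpen_interior.preimage continuous_subtype_val).mem_nhds (h1 ht))
    exact ⟨Z, hZ, hxZ, hZN⟩
  obtain ⟨O, hO, hOZ⟩ := isOpen_induced_iff.1 hZ.2
  have hEc : IsCompact ((fun t : T => (t : X)) '' Z) :=
    hZ.1.isCompact.image continuous_subtype_val
  have := eq_empty_of_relatively_clopen h.2 (hO.inter (isOpen_interior (s := N)))
    (E := (fun t : T => (t : X)) '' Z) hEc.isClosed hEc ?_ ?_
  · exact (Set.Nonempty.image _ ⟨_, hxZ⟩).ne_empty this
  · ext y
    constructor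
    · rintro ⟨t, ht, rfl⟩
      exact ⟨⟨hOZ.superset ht, hZN ht⟩, t.2.1⟩
    · rintro ⟨⟨hyO, hyN⟩, hyA⟩
      exact ⟨⟨y, hyA, interior_subset hyN⟩, hOZ.subset hyO, rfl⟩
  · refine (inter_eq_left.2 ?_).symm
    rintro _ ⟨t, -, rfl⟩
    exact t.2.1

end OnePoint

/-! ### Topological measures on locally compact spaces -/

section TopologicalMeasure

variable {X : Type*} [TopologicalSpace X] {m m' : Set X → ℝ≥0∞}

lemma IsTopologicalMeasure.mono_closed (hm : IsTopologicalMeasure m) {K L : Set X}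
    (hK : IsClosed K) (hL : IsClosed L) (h : K ⊆ L) : m K ≤ m L := by
  rw [hm.outer_regular K hK, hm.outer_regular L hL]
  exact sInf_le_sInf (image_mono fun U hU => ⟨hU.1, h.trans hU.2⟩)

lemma IsTopologicalMeasure.le_open (hm : IsTopologicalMeasure m) {K U : Set X}
    (hK : IsCompact K) (hU : IsOpen U) (h : K ⊆ U) : m K ≤ m U := by
  rw [hm.inner_regular U hU]
  exact le_sSup ⟨K, ⟨hK, h⟩, rfl⟩

lemma IsTopologicalMeasure.biUnion (hm : IsTopologicalMeasure m) (h0 : m ∅ = 0) {ι : Type*}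
    (s : Finset ι) (f : ι → Set X) (hf : (∀ i ∈ s, IsCompact (f i)) ∨ ∀ i ∈ s, IsOpen (f i))
    (hd : (s : Set ι).PairwiseDisjoint f) : m (⋃ i ∈ s, f i) = ∑ i ∈ s, m (f i) := by
  classical
  induction s using Finset.induction_on with
  | empty => simpa using h0
  | insert a s ha ih =>
    have hs : ∀ {p : Set X → Prop}, (∀ i ∈ insert a s, p (f i)) → p (f a) ∧ ∀ i ∈ s, p (f i) :=
      fun h => ⟨h a (by simp), fun i hi => h i (by simp [hi])⟩
    have hcase : ∀ t : Finset ι, ((∀ i ∈ t, IsCompact (f i)) ∨ ∀ i ∈ t, IsOpen (f i)) →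
        IsCompact (⋃ i ∈ t, f i) ∨ IsOpen (⋃ i ∈ t, f i) := fun t ht =>
      ht.imp (fun h => t.isCompact_biUnion h) (fun h => isOpen_biUnion h)
    have hf' : (∀ i ∈ s, IsCompact (f i)) ∨ ∀ i ∈ s, IsOpen (f i) :=
      hf.imp (fun h => (hs h).2) (fun h => (hs h).2)
    have hun := hcase _ hf
    rw [Finset.set_biUnion_insert] at hun ⊢
    rw [Finset.sum_insert ha, ← ih hf' (hd.subset (by simp))]
    refine hm.additive _ _ (hf.imp (fun h => (hs h).1) (fun h => (hs h).1)) (hcase s hf') hun ?_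
    rw [disjoint_iUnion₂_right]
    exact fun i hi => hd (by simp) (by simp [hi]) (fun h => ha (h ▸ hi))

/-- Topological measures that agree on open sets agree on closed sets, by outer regularity. -/
lemma IsTopologicalMeasure.eq_of_eq_open (hm : IsTopologicalMeasure m)
    (hm' : IsTopologicalMeasure m') (h : ∀ U, IsOpen U → m U = m' U) {A : Set X}
    (hA : IsOpen A ∨ IsClosed A) : m A = m' A := by
  rcases hA with hA | hA
  · exact h A hA
  · rw [hm.outer_regular A hA, hm'.outer_regular A hA]
    congr 1
    exact image_congr fun U hU => h U hU.1

end TopologicalMeasure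

/-! ### Restriction to the locally compact space -/

section OnePoint

open OnePoint

variable {X : Type*}

lemma image_preimage_coe {S : Set (OnePoint X)} (h : infty ∉ S) :
    (fun x : X => (x : OnePoint X)) '' ((fun x : X => (x : OnePoint X)) ⁻¹' S) = S := by
  refine image_preimage_eq_of_subset fun y hy => ?_
  exact ne_infty_iff_exists.1 (fun h' => h (h' ▸ hy))

variable [TopologicalSpace X]

lemma IsBddSolid.isSolidC_image {A : Set X} (h : IsBddSolid A) :
    IsSolidC ((fun x : X => (x : OnePoint X)) '' A) :=
  h.elim (fun h => h.2.isSolidC_image) (fun h => h.2.2.isSolidC_image)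

lemma isBddSolid_empty [NoncompactSpace X] [ConnectedSpace X] : IsBddSolid (∅ : Set X) := by
  refine Or.inl ⟨isCompact_empty, isPreconnected_empty, fun x _ h => ?_⟩
  rw [compl_empty, connectedComponentIn_univ, PreconnectedSpace.connectedComponent_eq_univ, IsBdd,
    closure_univ] at h
  exact noncompact_univ X h

lemma isCompactSolid_preimage [LocallyConnectedSpace X] {K : Set (OnePoint X)} (hK : IsClosed K)
    (hs : IsSolidC K) (h : infty ∉ K) :
    IsCompactSolid ((fun x : X => (x : OnePoint X)) ⁻¹' K) := by
  obtain ⟨h1, h2⟩ := (isClosed_iff_of_notMem h).1 hK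
  exact ⟨h2, isSolid_of_isSolidC_image_of_isClosed h1 (by rwa [image_preimage_coe h])⟩

variable [T2Space X]

lemma IsBddSolid.isOpen_or_isClosed_image {A : Set X} (h : IsBddSolid A) :
    IsOpen ((fun x : X => (x : OnePoint X)) '' A) ∨
      IsClosed ((fun x : X => (x : OnePoint X)) '' A) :=
  SolidSet.isOpen_or_isClosed_image (h.imp (fun h => h.1) (fun h => h.1))

lemma isBddOpenSolid_preimage [LocallyCompactSpace X] {U K : Set (OnePoint X)} (hU : IsOpen U)
    (hs : IsSolidC U) (hK : IsClosed K) (h : infty ∉ K) (hUK : U ⊆ K) :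
    IsBddOpenSolid ((fun x : X => (x : OnePoint X)) ⁻¹' U) := by
  obtain ⟨h1, h2⟩ := (isClosed_iff_of_notMem h).1 hK
  have hUo : IsOpen ((fun x : X => (x : OnePoint X)) ⁻¹' U) := hU.preimage continuous_coe
  refine ⟨hUo, h2.of_isClosed_subset isClosed_closure (closure_minimal (preimage_mono hUK) h1),
    isSolid_of_isSolidC_image_of_isOpen hUo ?_⟩
  rwa [image_preimage_coe fun h' => h (hUK h')]

variable [LocallyCompactSpace X] [NoncompactSpace X] [ConnectedSpace X] [LocallyConnectedSpace X]

/-- In genus zero the bounded solid sets have no nontrivial finite partitions: together with the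
complement in the compactification, such a partition would have more than two members. -/
lemma partition_eq_singleton (hg : genus (OnePoint X) = 0) {A : Set X} {P : Finset (Set X)}
    (hne : A.Nonempty) (hA : IsBddSolid A) (hP : ∀ B ∈ P, B.Nonempty ∧ IsBddSolid B)
    (hd : (P : Set (Set X)).PairwiseDisjoint id) (hPA : ⋃₀ (P : Set (Set X)) = A) : P = {A} := by
  classical
  have := locallyConnectedSpace_onePoint (X := X)
  set f : Set X → Set (OnePoint X) := fun B => (fun x : X => (x : OnePoint X)) '' B with hf
  have hfinj : Function.Injective f := image_injective.2 coe_injective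
  have hBA : ∀ B ∈ P, B ⊆ A := fun B hB => (subset_sUnion_of_mem (Finset.mem_coe.2 hB)).trans
    hPA.subset
  have hnotin : (f A)ᶜ ∉ P.image f := by
    intro h
    obtain ⟨B, hB, hBf⟩ := Finset.mem_image.1 h
    have : infty ∈ f B := by
      rw [hBf]
      exact infty_notMem_image_coe
    exact infty_notMem_image_coe this
  have hcard := card_partition_le_two hg (P := insert (f A)ᶜ (P.image f)) ?_ ?_ ?_ ?_ ?_
  · rw [Finset.card_insert_of_notMem hnotin, Finset.card_image_of_injective _ hfinj] at hcard
    have hPne : P.Nonempty := by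
      obtain ⟨x, hx⟩ := hne
      rw [← hPA] at hx
      obtain ⟨B, hB, -⟩ := hx
      exact ⟨B, hB⟩
    have hP1 : P.card = 1 := by
      have := Finset.card_pos.2 hPne
      omega
    obtain ⟨B, rfl⟩ := Finset.card_eq_one.1 hP1
    rw [← hPA]
    simp
  · intro S hS
    rcases Finset.mem_insert.1 hS with rfl | hS
    · exact ⟨infty, infty_notMem_image_coe⟩
    · obtain ⟨B, hB, rfl⟩ := Finset.mem_image.1 hS
      exact (hP B hB).1.image _
  · intro S hS
    rcases Finset.mem_insert.1 hS with rfl | hS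
    · exact hA.isSolidC_image.compl
    · obtain ⟨B, hB, rfl⟩ := Finset.mem_image.1 hS
      exact (hP B hB).2.isSolidC_image
  · intro S hS
    rcases Finset.mem_insert.1 hS with rfl | hS
    · rw [isOpen_compl_iff, isClosed_compl_iff]
      exact hA.isOpen_or_isClosed_image.symm
    · obtain ⟨B, hB, rfl⟩ := Finset.mem_image.1 hS
      exact (hP B hB).2.isOpen_or_isClosed_image
  · rw [Finset.coe_insert, pairwiseDisjoint_insert_of_notMem (by exact_mod_cast hnotin)]
    constructor
    · rw [Finset.coe_image]
      rintro _ ⟨B, hB, rfl⟩ _ ⟨B', hB', rfl⟩ hBB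
      exact (disjoint_image_iff coe_injective).2 (hd hB hB' (fun h => hBB (h ▸ rfl)))
    · intro S hS
      obtain ⟨B, hB, rfl⟩ := Finset.mem_image.1 (Finset.mem_coe.1 hS)
      exact disjoint_compl_left.mono_right (image_mono (hBA B hB))
  · have : ⋃₀ ((P.image f : Finset (Set (OnePoint X))) : Set (Set (OnePoint X))) = f A := by
      rw [Finset.coe_image, hf, ← hPA]
      ext y
      constructor
      · rintro ⟨_, ⟨B, hB, rfl⟩, x, hx, rfl⟩
        exact ⟨x, ⟨B, hB, hx⟩, rfl⟩
      · rintro ⟨x, ⟨B, hB, hx⟩, rfl⟩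
        exact ⟨_, ⟨B, hB, rfl⟩, x, hx, rfl⟩
    rw [Finset.coe_insert, sUnion_insert, this, compl_union_self]

/-- In genus zero a solid set function on the compactification restricts to one on the space. -/
lemma IsSolidSetFunctionC.isSolidSetFunction (hg : genus (OnePoint X) = 0)
    {ν : Set (OnePoint X) → ℝ≥0} (hν : IsSolidSetFunctionC ν) {μ : Set X → ℝ≥0}
    (hμ : ∀ A, IsBddSolid A → μ A = ν ((fun x : X => (x : OnePoint X)) '' A)) :
    IsSolidSetFunction μ := by
  classical
  have := locallyConnectedSpace_onePoint (X := X)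
  have hcl : ∀ {K : Set X}, IsCompactSolid K →
      IsClosed ((fun x : X => (x : OnePoint X)) '' K) ∧
        IsSolidC ((fun x : X => (x : OnePoint X)) '' K) :=
    fun h => ⟨isClosed_image_coe.2 ⟨h.1.isClosed, h.1⟩, h.2.isSolidC_image⟩
  have hempty : μ ∅ = 0 := by
    rw [hμ ∅ isBddSolid_empty, image_empty, hν.empty]
  have hle : ∀ {K U : Set X}, IsCompactSolid K → IsBddOpenSolid U → K ⊆ U → μ K ≤ μ U := by
    intro K U hK hU hKU
    rw [hμ K (Or.inl hK), hμ U (Or.inr hU)]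
    exact (hν.inner_regular _ (isOpen_image_coe.2 hU.1) hU.2.2.isSolidC_image).1
      ⟨_, ⟨hcl hK, image_mono hKU⟩, rfl⟩
  refine ⟨?_, ?_, ?_, ?_⟩
  · intro n C D hC hD hd hCD
    rw [hμ D (Or.inl hD), Finset.sum_congr rfl fun i _ => hμ (C i) (Or.inl (hC i))]
    refine hν.superadditive n (fun i => (fun x : X => (x : OnePoint X)) '' C i) _
      (fun i => hcl (hC i)) (hcl hD) ?_ ?_
    · exact fun i j hij => (disjoint_image_iff coe_injective).2 (hd hij)
    · rw [← image_iUnion]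
      exact image_mono hCD
  · intro U hU
    have h := hν.inner_regular _ (isOpen_image_coe.2 hU.1) hU.2.2.isSolidC_image
    refine ⟨?_, fun b hb => ?_⟩
    · rintro _ ⟨K, ⟨hK, hKU⟩, rfl⟩
      exact hle hK hU hKU
    · rw [hμ U (Or.inr hU)]
      refine h.2 ?_
      rintro _ ⟨L, ⟨⟨hL, hLs⟩, hLU⟩, rfl⟩
      have hinf : infty ∉ L := fun h' => infty_notMem_image_coe (hLU h')
      have hK := isCompactSolid_preimage hL hLs hinf
      have := hb ⟨_, ⟨hK, fun x hx => ?_⟩, rfl⟩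
      · rwa [hμ _ (Or.inl hK), image_preimage_coe hinf] at this
      · obtain ⟨y, hy, hyx⟩ := hLU hx
        exact coe_injective hyx ▸ hy
  · intro K hK
    refine ⟨?_, fun b hb => ?_⟩
    · rintro _ ⟨U, ⟨hU, hKU⟩, rfl⟩
      exact hle hK hU hKU
    · rw [← NNReal.coe_le_coe]
      refine le_of_forall_pos_le_add fun ε hε => ?_
      obtain ⟨L, hL, hKL⟩ := exists_compact_superset hK.1
      obtain ⟨O, ⟨hO, hOs⟩, hKO, hOL, hOε⟩ := hν.exists_open_solid (hcl hK).1 (hcl hK).2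
        (isOpen_image_coe.2 (isOpen_interior (s := L))) (image_mono hKL) hε
      have hOL' := hOL.trans (image_mono (interior_subset (s := L)))
      have hU := isBddOpenSolid_preimage hO hOs (isClosed_image_coe.2 ⟨hL.isClosed, hL⟩)
        infty_notMem_image_coe hOL'
      have := hb ⟨_, ⟨hU, fun x hx => hKO ⟨x, hx, rfl⟩⟩, rfl⟩
      rw [hμ _ (Or.inr hU), image_preimage_coe fun h' => infty_notMem_image_coe (hOL' h')] at this
      rw [hμ K (Or.inl hK)]
      exact (NNReal.coe_le_coe.2 this).trans hOε
  · intro n A hA hU hd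
    rcases (⋃ i, A i).eq_empty_or_nonempty with he | hne
    · have : ∀ i, A i = ∅ := iUnion_eq_empty.1 he
      simp [this, hempty]
    · have hP := partition_eq_singleton hg hne hU
        (P := (Finset.univ.image A).filter Set.Nonempty) ?_ ?_ ?_
      · have hmem : (⋃ i, A i) ∈ (Finset.univ.image A).filter Set.Nonempty := by
          rw [hP]
          exact Finset.mem_singleton_self _
        obtain ⟨i, -, hi⟩ := Finset.mem_image.1 (Finset.mem_filter.1 hmem).1
        rw [Finset.sum_eq_single i, hi]
        · intro j _ hji
          have : A j = ∅ := by
            refine disjoint_self.1 ((hd hji).mono_right ?_)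
            rw [hi]
            exact subset_iUnion A j
          rw [this, hempty]
        · simp
      · intro B hB
        obtain ⟨hB, hBne⟩ := Finset.mem_filter.1 hB
        obtain ⟨i, -, rfl⟩ := Finset.mem_image.1 hB
        exact ⟨hBne, hA i⟩
      · intro B hB B' hB' hBB
        obtain ⟨i, -, rfl⟩ := Finset.mem_image.1 (Finset.mem_filter.1 (Finset.mem_coe.1 hB)).1
        obtain ⟨j, -, rfl⟩ := Finset.mem_image.1 (Finset.mem_filter.1 (Finset.mem_coe.1 hB')).1
        exact hd fun h => hBB (h ▸ rfl)
      · ext x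
        simp only [mem_sUnion, Finset.mem_coe, Finset.mem_filter, Finset.mem_image,
          Finset.mem_univ, true_and, mem_iUnion]
        constructor
        · rintro ⟨_, ⟨⟨i, rfl⟩, -⟩, hx⟩
          exact ⟨i, hx⟩
        · rintro ⟨i, hx⟩
          exact ⟨A i, ⟨⟨i, rfl⟩, x, hx⟩, hx⟩

/-- The restriction of the topological measure on the compactification is one on the space. -/
lemma IsSolidSetFunctionC.isTopologicalMeasure (hg : genus (OnePoint X) = 0)
    {ν : Set (OnePoint X) → ℝ≥0} (hν : IsSolidSetFunctionC ν) :
    IsTopologicalMeasure fun A : Set X =>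
      ENNReal.ofReal (extension ν ((fun x : X => (x : OnePoint X)) '' A)) := by
  have := locallyConnectedSpace_onePoint (X := X)
  refine ⟨⟨∅, Or.inl isOpen_empty, ENNReal.ofReal_ne_top⟩, ?_, ?_, ?_⟩
  · intro A B hA hB hAB hd
    rw [image_union, hν.extension_union hg (isOpen_or_isClosed_image hA)
      (isOpen_or_isClosed_image hB) ?_ ((disjoint_image_iff coe_injective).2 hd),
      ENNReal.ofReal_add (hν.extension_nonneg _) (hν.extension_nonneg _)]
    rw [← image_union]
    exact isOpen_or_isClosed_image hAB
  · intro U hU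
    refine le_antisymm (le_of_forall_lt fun r hr => ?_) (sSup_le ?_)
    · have hrt : r ≠ ⊤ := hr.ne_top
      rw [ENNReal.lt_ofReal_iff_toReal_lt hrt,
        hν.extension_open (isOpen_image_coe.2 hU)] at hr
      obtain ⟨𝒦, h𝒦, h𝒦U, hlt⟩ := exists_lt_of_lt_openValue hr
      have hinf : infty ∉ ⋃₀ (𝒦 : Set (Set (OnePoint X))) :=
        fun h => infty_notMem_image_coe (h𝒦U h)
      have hle : r.toReal < extension ν ((fun x : X => (x : OnePoint X)) ''
          ((fun x : X => (x : OnePoint X)) ⁻¹' ⋃₀ (𝒦 : Set (Set (OnePoint X))))) := by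
        rwa [image_preimage_coe hinf, hν.extension_tameFamily hg h𝒦]
      rw [← ENNReal.lt_ofReal_iff_toReal_lt hrt] at hle
      refine hle.trans_le (le_sSup ⟨_, ⟨((isClosed_iff_of_notMem hinf).1 h𝒦.isClosed_sUnion).2,
        fun x hx => ?_⟩, rfl⟩)
      obtain ⟨y, hy, hyx⟩ := h𝒦U hx
      exact coe_injective hyx ▸ hy
    · rintro _ ⟨K, ⟨-, hKU⟩, rfl⟩
      exact ENNReal.ofReal_le_ofReal (hν.extension_mono (image_mono hKU))
  · intro F _
    refine le_antisymm (le_sInf ?_) (ENNReal.le_of_forall_pos_le_add fun ε hε _ => ?_)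
    · rintro _ ⟨U, ⟨-, hFU⟩, rfl⟩
      exact ENNReal.ofReal_le_ofReal (hν.extension_mono (image_mono hFU))
    · obtain ⟨U, hU, hFU, hlt⟩ := exists_openValue_lt (lt_add_of_pos_right
        (extension ν ((fun x : X => (x : OnePoint X)) '' F)) (NNReal.coe_pos.2 hε))
      refine (sInf_le (mem_image_of_mem _ (show (fun x : X => (x : OnePoint X)) ⁻¹' U ∈
        {U | IsOpen U ∧ F ⊆ U} from
        ⟨hU.preimage continuous_coe, image_subset_iff.1 hFU⟩))).trans ?_
      rw [← ENNReal.ofReal_coe_nnreal, ← ENNReal.ofReal_add (hν.extension_nonneg _) ε.coe_nonneg]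
      exact ENNReal.ofReal_le_ofReal ((hν.extension_le hU (image_preimage_subset _ _)).trans hlt.le)

/-- Two topological measures with the same finite values on bounded solid sets agree on the tame
continua: such a continuum and the bounded components of its complement make up a compact solid
set, and these components are bounded open solid sets. -/
lemma IsTopologicalMeasure.eq_on_tame {m m' : Set X → ℝ≥0∞} {μ : Set X → ℝ≥0}
    (hm : IsTopologicalMeasure m) (hm' : IsTopologicalMeasure m')
    (h : ∀ A, IsBddSolid A → m A = μ A) (h' : ∀ A, IsBddSolid A → m' A = μ A)
    (h0 : μ ∅ = 0) {K : Set (OnePoint X)} (hK : IsTame K) (hinf : infty ∉ K) :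
    m ((fun x : X => (x : OnePoint X)) ⁻¹' K) = m' ((fun x : X => (x : OnePoint X)) ⁻¹' K) := by
  classical
  have := locallyConnectedSpace_onePoint (X := X)
  set g : Set (OnePoint X) → Set X := fun B => (fun x : X => (x : OnePoint X)) ⁻¹' B with hgdef
  have hBinf : connectedComponentIn Kᶜ infty ∈ hK.branches :=
    hK.mem_branches.2 ⟨infty, hinf, rfl⟩
  set B₀ := connectedComponentIn Kᶜ infty with hB₀
  have hinfB : infty ∉ B₀ᶜ := fun h => h (mem_connectedComponentIn hinf)
  have hcl : IsClosed B₀ᶜ := (hK.isOpen_branch hBinf).isClosed_compl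
  have hD : IsCompactSolid (g B₀ᶜ) :=
    isCompactSolid_preimage hcl (hK.isSolidC_branch hBinf).compl hinfB
  have hdisj : ∀ B ∈ hK.branches, ∀ C ∈ hK.branches, B ≠ C → Disjoint B C := fun B hB C hC hne =>
    pairwiseDisjoint_components _ (hK.mem_branches.1 hB) (hK.mem_branches.1 hC) hne
  have hB : ∀ B ∈ hK.branches.erase B₀, IsBddOpenSolid (g B) := by
    intro B hB
    obtain ⟨hne, hB⟩ := Finset.mem_erase.1 hB
    exact isBddOpenSolid_preimage (hK.isOpen_branch hB) (hK.isSolidC_branch hB) hcl hinfB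
      (hdisj B hB B₀ hBinf hne).subset_compl_right
  have hunion : g K ∪ ⋃ B ∈ hK.branches.erase B₀, g B = g B₀ᶜ := by
    ext x
    constructor
    · rintro (hx | hx) hxB
      · exact (hK.branch_disjoint hBinf).le_bot ⟨hx, hxB⟩
      · obtain ⟨B, hB, hxB'⟩ := mem_iUnion₂.1 hx
        obtain ⟨hne, hB⟩ := Finset.mem_erase.1 hB
        exact (hdisj B hB B₀ hBinf hne).le_bot ⟨hxB', hxB⟩
    · intro hx
      by_cases hxK : (x : OnePoint X) ∈ K
      · exact Or.inl hxK
      · refine Or.inr (mem_iUnion₂.2 ⟨connectedComponentIn Kᶜ x, Finset.mem_erase.2 ⟨?_,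
          hK.mem_branches.2 ⟨x, hxK, rfl⟩⟩, mem_connectedComponentIn hxK⟩)
        intro heq
        exact hx (heq ▸ mem_connectedComponentIn hxK)
  have hKc : IsCompact (g K) := ((isClosed_iff_of_notMem hinf).1 hK.isClosed).2
  -- additivity determines the value on `K`
  have key : ∀ n : Set X → ℝ≥0∞, IsTopologicalMeasure n → (∀ A, IsBddSolid A → n A = μ A) →
      n (g K) + ∑ B ∈ hK.branches.erase B₀, (μ (g B) : ℝ≥0∞) = μ (g B₀ᶜ) := by
    intro n hn hnμ
    have hn0 : n ∅ = 0 := by rw [hnμ ∅ isBddSolid_empty, h0, ENNReal.coe_zero]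
    have hopen : ∀ B ∈ hK.branches.erase B₀, IsOpen (g B) := fun B hB' => (hB B hB').1
    have hU : IsOpen (⋃ B ∈ hK.branches.erase B₀, g B) := isOpen_biUnion hopen
    rw [← hnμ _ (Or.inl hD), ← hunion, hn.additive _ _ (Or.inl hKc) (Or.inr hU)
      (Or.inl (hunion ▸ hD.1)), hn.biUnion hn0 _ g (Or.inr hopen)]
    · rw [Finset.sum_congr rfl fun B hB' => hnμ _ (Or.inr (hB B hB'))]
    · intro B hB' C hC hne
      exact (hdisj B (Finset.mem_of_mem_erase hB') C (Finset.mem_of_mem_erase hC) hne).preimage _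
    · rw [disjoint_iUnion₂_right]
      exact fun B hB' => (hK.branch_disjoint (Finset.mem_of_mem_erase hB')).preimage _
  have hfin : ∑ B ∈ hK.branches.erase B₀, (μ (g B) : ℝ≥0∞) ≠ ⊤ :=
    ENNReal.sum_ne_top.2 fun _ _ => ENNReal.coe_ne_top
  exact (ENNReal.add_left_inj hfin).1 ((key m hm h).trans (key m' hm' h').symm)

lemma IsTopologicalMeasure.le_of_eq_on_bddSolid (hg : genus (OnePoint X) = 0)
    {m m' : Set X → ℝ≥0∞} {μ : Set X → ℝ≥0}
    (hm : IsTopologicalMeasure m) (hm' : IsTopologicalMeasure m')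
    (h : ∀ A, IsBddSolid A → m A = μ A) (h' : ∀ A, IsBddSolid A → m' A = μ A)
    (h0 : μ ∅ = 0) {U : Set X} (hU : IsOpen U) : m U ≤ m' U := by
  have := locallyConnectedSpace_onePoint (X := X)
  rw [hm.inner_regular U hU]
  refine sSup_le ?_
  rintro _ ⟨K, ⟨hK, hKU⟩, rfl⟩
  obtain ⟨𝒦, h𝒦, hK𝒦, h𝒦U⟩ := exists_tameFamily_between hg
    (isClosed_image_coe.2 ⟨hK.isClosed, hK⟩) (isOpen_image_coe.2 hU) (image_mono hKU)
  set g : Set (OnePoint X) → Set X := fun B => (fun x : X => (x : OnePoint X)) ⁻¹' B with hgdef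
  have hinf : ∀ L ∈ 𝒦, infty ∉ L := fun L hL hL' =>
    infty_notMem_image_coe (h𝒦U ⟨L, hL, hL'⟩)
  have hc : ∀ L ∈ 𝒦, IsCompact (g L) := fun L hL =>
    ((isClosed_iff_of_notMem (hinf L hL)).1 (h𝒦.isTame L hL).isClosed).2
  have hd : (𝒦 : Set (Set (OnePoint X))).PairwiseDisjoint g := fun L hL M hM hne =>
    (h𝒦.disjoint hL hM hne).preimage _
  have hcU : IsCompact (⋃ L ∈ 𝒦, g L) := 𝒦.isCompact_biUnion hc
  have hn0 : ∀ n : Set X → ℝ≥0∞, (∀ A, IsBddSolid A → n A = μ A) → n ∅ = 0 := fun n hn => by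
    rw [hn ∅ isBddSolid_empty, h0, ENNReal.coe_zero]
  calc m K ≤ m (⋃ L ∈ 𝒦, g L) := by
        refine hm.mono_closed hK.isClosed hcU.isClosed fun x hx => ?_
        obtain ⟨L, hL, hxL⟩ := hK𝒦 ⟨x, hx, rfl⟩
        exact mem_iUnion₂.2 ⟨L, hL, hxL⟩
    _ = m' (⋃ L ∈ 𝒦, g L) := by
        rw [hm.biUnion (hn0 m h) _ g (Or.inl hc) hd, hm'.biUnion (hn0 m' h') _ g (Or.inl hc) hd]
        exact Finset.sum_congr rfl fun L hL =>
          hm.eq_on_tame hm' h h' h0 (h𝒦.isTame L hL) (hinf L hL)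
    _ ≤ m' U := by
        refine hm'.le_open hcU hU (iUnion₂_subset fun L hL x hx => ?_)
        obtain ⟨y, hy, hyx⟩ := h𝒦U ⟨L, hL, hx⟩
        exact coe_injective hyx ▸ hy

end OnePoint

end SolidSet

theorem theorem8 {X : Type*} [TopologicalSpace X] [T2Space X] [LocallyCompactSpace X]
    [NoncompactSpace X] [ConnectedSpace X] [LocallyConnectedSpace X]
    (hg : SolidSet.genus (OnePoint X) = 0)
    (ν : Set (OnePoint X) → ℝ≥0) (hν : SolidSet.IsSolidSetFunctionC ν)
    (μ : Set X → ℝ≥0)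
    (hμ : ∀ A : Set X, SolidSet.IsBddSolid A → μ A = ν ((fun x : X => (x : OnePoint X)) '' A)) :
    -- every bounded open solid or compact solid set is solid in the compactification, and open
    -- or closed there, so that the restriction is meaningful
    (∀ A : Set X, SolidSet.IsBddSolid A →
      SolidSet.IsSolidC ((fun x : X => (x : OnePoint X)) '' A) ∧
      (IsOpen ((fun x : X => (x : OnePoint X)) '' A) ∨
        IsClosed ((fun x : X => (x : OnePoint X)) '' A))) ∧
    -- the restriction is a solid set function
    SolidSet.IsSolidSetFunction μ ∧
    -- it extends to a topological measure, which is compact-finite and unique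
    (∃ m : Set X → ℝ≥0∞, SolidSet.IsTopologicalMeasure m ∧
      (∀ A : Set X, SolidSet.IsBddSolid A → m A = (μ A : ℝ≥0∞)) ∧
      (∀ K : Set X, IsCompact K → m K < ∞) ∧
      ∀ m' : Set X → ℝ≥0∞, SolidSet.IsTopologicalMeasure m' →
        (∀ A : Set X, SolidSet.IsBddSolid A → m' A = (μ A : ℝ≥0∞)) →
        ∀ A : Set X, IsOpen A ∨ IsClosed A → m' A = m A) ∧
    -- solid partitions of bounded solid sets are trivial
    (∀ (A : Set X) (P : Finset (Set X)), A.Nonempty → SolidSet.IsBddSolid A →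
      (∀ B ∈ P, B.Nonempty ∧ SolidSet.IsBddSolid B) →
      (P : Set (Set X)).PairwiseDisjoint id → ⋃₀ (P : Set (Set X)) = A → P = {A}) := by
  have := SolidSet.locallyConnectedSpace_onePoint (X := X)
  have h0 : μ ∅ = 0 := by
    rw [hμ ∅ SolidSet.isBddSolid_empty, Set.image_empty, hν.empty]
  have hext : ∀ A : Set X, SolidSet.IsBddSolid A →
      ENNReal.ofReal (SolidSet.extension ν ((fun x : X => (x : OnePoint X)) '' A)) = μ A := by
    intro A hA
    rw [hν.extension_solid hg hA.isOpen_or_isClosed_image hA.isSolidC_image, hμ A hA,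
      ENNReal.ofReal_coe_nnreal]
  have hm := hν.isTopologicalMeasure hg
  refine ⟨fun A hA => ⟨hA.isSolidC_image, hA.isOpen_or_isClosed_image⟩,
    hν.isSolidSetFunction hg hμ, ⟨_, hm, hext, fun K _ => ENNReal.ofReal_lt_top, ?_⟩,
    fun A P hne hA hP hd hPA => SolidSet.partition_eq_singleton hg hne hA hP hd hPA⟩
  intro m' hm' hext' A hA
  exact hm'.eq_of_eq_open hm (fun U hU => le_antisymm
    (hm'.le_of_eq_on_bddSolid hg hm hext' hext h0 hU)
    (hm.le_of_eq_on_bddSolid hg hm' hext hext' h0 hU)) hA
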